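/- Fix an integer $k\ge 0$ and let $\mathbb S_k$ be the slab: the graph with vertex set $\mathbb Z^2\times\{0,\dots,k\}$ and edges between nearest neighbours. For $p\in[0,1]$ let $\mathbf P_p$ be Bernoulli bond percolation on $\mathbb S_k$: the edges are open with probability $p$, independently. For $E\subset\mathbb Z^2$ put $\overline E=E\times\{0,\dots,k\}$. For $B,X,Y\subset\mathbb Z^2$ let $X\overset{B}{\longleftrightarrow}Y$ be the event that some open cluster in $\overline B$ (a connected component of the graph formed by the vertices of $\overline B$ and the open edges with both endpoints in $\overline B$) contains a vertex of $\overline X$ and a vertex of $\overline Y$. Let $B_n=[-n,n]^2\cap\mathbb Z^2$. Let $(u_m)$, $(\alpha_m)$, $(y_m)$ be sequences of non-negative integers with $u_m\le m/3$, $\alpha_m\le m$ and $y_m\le m$ for all $m$. Put $S_m=B_{u_m}$ and, for $n\ge 1$ and $y=y_{3n}$, $$B_n'=(2n,y)+B_n,\qquad S_n'=(2n,y)+S_n,$$ $$Y_n^+=\{3n\}\times[y+\alpha_n,y+n],\quad Y_n^-=\{3n\}\times[y-n,y-\alpha_n],\quad Z_n=\{3n\}\times[y-\alpha_n,y+\alpha_n]$$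 (intervals of integers). **Gluing Lemma.** For every $\varepsilon>0$ there exists $\delta=\delta(\varepsilon,k)>0$, depending only on $\varepsilon$ and $k$, such that for every $p\in[0,1]$, all sequences $(u_m),(\alpha_m),(y_m)$ as above and every $n\ge 1$, $$\mathbf P_p\big[S_{3n}\overset{B_{3n}}{\longleftrightarrow}Z_n,\ S_n'\overset{B_n'}{\longleftrightarrow}Y_n^-,\ S_n'\overset{B_n'}{\longleftrightarrow}Y_n^+\big]\ge 1-\delta$$ implies $$\mathbf P_p\big[S_{3n}\overset{B_{3n}\cup B_n'}{\longleftrightarrow}S_n'\big]\ge 1-\varepsilon .$$ -/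

import Mathlib

open MeasureTheory
open scoped Pointwise

namespace SlabPercolation

/-- Vertices of the slab of width `k`: the product of `ℤ²` with `{0, …, k}`. -/
abbrev Vertex (k : ℕ) : Type := (ℤ × ℤ) × Fin (k + 1)

/-- The slab of width `k`: two vertices are adjacent when they are nearest neighbours,
that is, at `ℓ¹`-distance one. -/
def slab (k : ℕ) : SimpleGraph (Vertex k) where
  Adj v w := |v.1.1 - w.1.1| + |v.1.2 - w.1.2| + |((v.2 : ℕ) : ℤ) - ((w.2 : ℕ) : ℤ)| = 1
  symm := ⟨fun v w h => by
    rw [abs_sub_comm w.1.1, abs_sub_comm w.1.2, abs_sub_comm ((w.2 : ℕ) : ℤ)]; exact h⟩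
  loopless := ⟨fun v h => by simp at h⟩

/-- A percolation configuration: every edge is open (`true`) or closed (`false`). -/
abbrev Config (k : ℕ) : Type := (slab k).edgeSet → Bool

/-- Bernoulli bond percolation: the edges are independently open with probability `p`. -/
noncomputable def bernoulliPerc (k : ℕ) (p : unitInterval) : Measure (Config k) :=
  Measure.infinitePi fun _ => ProbabilityTheory.bernoulliMeasure true false p

/-- The graph of all vertices of the slab and the open edges of `ω`. -/
def openGraph {k : ℕ} (ω : Config k) : SimpleGraph (Vertex k) where
  Adj v w := ∃ h : s(v, w) ∈ (slab k).edgeSet, ω ⟨s(v, w), h⟩ = true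
  symm := ⟨fun v w ⟨h, ho⟩ => by
    have e : s(w, v) = s(v, w) := Sym2.eq_swap
    rw [e]; exact ⟨h, ho⟩⟩
  loopless := ⟨fun v ⟨h, _⟩ => (slab k).loopless.irrefl v h⟩

/-- The set of vertices of the slab whose first two coordinates lie in `E`. -/
def lift (k : ℕ) (E : Set (ℤ × ℤ)) : Set (Vertex k) := {v | v.1 ∈ E}

/-- The event that some open cluster in `lift k B` (a connected component of the graph of the
vertices of `lift k B` and the open edges with both endpoints there) meets `lift k X` and
`lift k Y`. -/
def connected (k : ℕ) (B X Y : Set (ℤ × ℤ)) : Set (Config k) :=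
  {ω | ∃ C : ((openGraph ω).induce (lift k B)).ConnectedComponent,
    (∃ x ∈ C.supp, (x : Vertex k) ∈ lift k X) ∧ (∃ y ∈ C.supp, (y : Vertex k) ∈ lift k Y)}

/-- The box `[-n, n]²` in `ℤ²`. -/
def box (n : ℕ) : Set (ℤ × ℤ) := Set.Icc (-(n : ℤ)) n ×ˢ Set.Icc (-(n : ℤ)) n

section Sets

variable (u α y : ℕ → ℕ) (n : ℕ)

/-- The box `Sₙ = B_{uₙ}`. -/
def S : Set (ℤ × ℤ) := box (u n)

/-- `B'ₙ = (2n, y₃ₙ) + Bₙ`. -/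
def B' : Set (ℤ × ℤ) := ((2 * n : ℤ), (y (3 * n) : ℤ)) +ᵥ box n

/-- `S'ₙ = (2n, y₃ₙ) + Sₙ`. -/
def S' : Set (ℤ × ℤ) := ((2 * n : ℤ), (y (3 * n) : ℤ)) +ᵥ S u n

/-- `Yₙ⁺ = {3n} × [y₃ₙ + αₙ, y₃ₙ + n]`. -/
def Yplus : Set (ℤ × ℤ) :=
  {(3 * n : ℤ)} ×ˢ Set.Icc ((y (3 * n) : ℤ) + α n) ((y (3 * n) : ℤ) + n)

/-- `Yₙ⁻ = {3n} × [y₃ₙ - n, y₃ₙ - αₙ]`. -/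
def Yminus : Set (ℤ × ℤ) :=
  {(3 * n : ℤ)} ×ˢ Set.Icc ((y (3 * n) : ℤ) - n) ((y (3 * n) : ℤ) - α n)

/-- `Zₙ = {3n} × [y₃ₙ - αₙ, y₃ₙ + αₙ]`. -/
def Z : Set (ℤ × ℤ) :=
  {(3 * n : ℤ)} ×ˢ Set.Icc ((y (3 * n) : ℤ) - α n) ((y (3 * n) : ℤ) + α n)

end Sets

end SlabPercolation

/-! Suppose the three connections hold but the clusters of $S_{3n}$ and $S_n'$ in the union of the
two boxes are disjoint. Let $\gamma$ be the minimal open path from $S_{3n}$ to $Z_n$. Planarity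
prevents the two paths from $S_n'$ to $Y_n^\pm$ from both avoiding the columns of $\gamma$
(`planar_paths_meet`), although they never touch $\gamma$ itself. Call a column of $\gamma$ a
candidate if it is next to a vertex joined to $S_n'$ in $B_n'$ off the columns of $\gamma$. Fix a
threshold $t$.

If there are at most $t$ candidates, close every edge meeting them except those of $\gamma$. The
hypothesis now fails, and the candidates can still be read off the result, so this case has
probability at most $C^{t}\,\mathbf P[\text{hypothesis fails}]$ (`bern_few_candidates`). If there
are more than $t$, then at each candidate, with at most one exception, boundedly many changes
connect $S_n'$ to $\gamma$ in that column. Afterwards $\gamma$ is still minimal and that column is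
the only place where the cluster of $S_n'$ touches it. One state thus has at least $t$ distinct
images, while each image has boundedly many preimages, so this case has probability at most $C/t$
(`bern_many_candidates`). Choosing $t$ large and then $\delta$ small proves the lemma. Both cases
use the multivalued map principle `mul_bern_real_le_of_modification`.

The delicate point is that $\gamma$ stays minimal (`Glueable.isMin_surgery`). To ensure it, the
lexicographic order on paths is itself random: each ordered pair of vertices carries an auxiliary
preference bit, independent of the edges, and the surgery also sets these bits so that $\gamma$ is
preferred in the modified column.

The constant $C$ blows up as $p\to0$ or $p\to1$, while $\delta$ must not depend on $p$. For small
$p$ the hypothesis itself is unlikely, since it needs an open path over a distance of at least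
$2n/3$. For $p$ near $1$, two disjoint clusters reaching the line $x=3n$ are separated by a long
chain of closed edges (`linked_of_separated`). The same Peierls estimate `bern_real_linked_le`
bounds both. -/

namespace SlabPercolation

/-! ### Bernoulli product measures and the cost of local modifications. -/

/-- Independent Bernoulli variables of parameter `p` indexed by `ι`. -/
noncomputable def bern (ι : Type*) (p : unitInterval) : Measure (ι → Bool) :=
  Measure.infinitePi fun _ => ProbabilityTheory.bernoulliMeasure true false p

instance (ι : Type*) (p : unitInterval) : IsProbabilityMeasure (bern ι p) := by
  unfold bern; infer_instance

/-- The mass of a single value under the Bernoulli distribution. -/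
noncomputable def mass (p : unitInterval) (b : Bool) : ℝ := if b then p else 1 - p

lemma mass_nonneg (p : unitInterval) (b : Bool) : 0 ≤ mass p b := by
  unfold mass; split_ifs
  · exact p.2.1
  · linarith [p.2.2]

lemma mass_le_one (p : unitInterval) (b : Bool) : mass p b ≤ 1 := by
  unfold mass; split_ifs
  · exact p.2.2
  · linarith [p.2.1]

lemma bernoulli_real_singleton (p : unitInterval) (b : Bool) :
    (ProbabilityTheory.bernoulliMeasure true false p).real {b} = mass p b := by
  rw [ProbabilityTheory.bernoulliMeasure_real_apply _ (measurableSet_singleton b)]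
  cases b <;> simp [mass]

lemma bern_real_forall_eq {ι : Type*} (p : unitInterval) (b : Bool) (s : Finset ι) :
    (bern ι p).real {ω | ∀ i ∈ s, ω i = b} = mass p b ^ s.card := by
  have h : {ω : ι → Bool | ∀ i ∈ s, ω i = b} = Set.pi s fun _ => {b} := by
    ext ω; simp [Set.mem_pi]
  rw [h, measureReal_def, bern, Measure.infinitePi_pi _ fun i _ => measurableSet_singleton b,
    ENNReal.toReal_prod]
  simp only [← measureReal_def, bernoulli_real_singleton, Finset.prod_const]

lemma bern_real_singleton {ι : Type*} [Fintype ι] (p : unitInterval) (ω : ι → Bool) :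
    (bern ι p).real {ω} = ∏ i, mass p (ω i) := by
  rw [measureReal_def, bern, Measure.infinitePi_singleton_of_fintype, ENNReal.toReal_prod]
  simp only [← measureReal_def, bernoulli_real_singleton]

lemma bern_map_comp {ι J : Type*} (p : unitInterval) (f : ι → J) (hf : Function.Injective f) :
    (bern J p).map (fun ω => ω ∘ f) = bern ι p := by
  classical
  have hm : Measurable fun ω : J → Bool => ω ∘ f :=
    measurable_pi_lambda _ fun i => measurable_pi_apply (f i)
  refine Measure.eq_infinitePi _ fun s t ht => ?_
  rw [Measure.map_apply hm (MeasurableSet.pi s.countable_toSet fun i _ => ht i)]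
  set t' : J → Set Bool := fun j => {b | ∀ i, f i = j → b ∈ t i} with ht'
  have e1 : ∀ i, t' (f i) = t i := fun i => by
    ext b; exact ⟨fun h => h i rfl, fun h i' hi => hf hi ▸ h⟩
  have e2 : (fun ω : J → Bool => ω ∘ f) ⁻¹' (Set.pi s t) = Set.pi (s.image f) t' := by
    ext ω; simp [Set.mem_pi, e1]
  rw [e2, bern, Measure.infinitePi_pi _ (fun i _ => Set.Finite.measurableSet (Set.toFinite _)),
    Finset.prod_image fun a _ b _ h => hf h]
  simp only [e1]

lemma bern_real_comp {ι J : Type*} [Finite ι] (p : unitInterval) (f : ι → J)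
    (hf : Function.Injective f) (A : Set (ι → Bool)) :
    (bern J p).real {ω | ω ∘ f ∈ A} = (bern ι p).real A := by
  have hm : Measurable fun ω : J → Bool => ω ∘ f :=
    measurable_pi_lambda _ fun i => measurable_pi_apply (f i)
  rw [← bern_map_comp p f hf, map_measureReal_apply hm A.toFinite.measurableSet]
  rfl

lemma bern_real_eq_sum {ι : Type*} [Fintype ι] [DecidableEq ι] (p : unitInterval)
    (A : Set (ι → Bool))
    [DecidablePred (· ∈ A)] :
    (bern ι p).real A = ∑ ω with ω ∈ A, ∏ i, mass p (ω i) := by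
  simp_rw [← bern_real_singleton]
  rw [sum_measureReal_singleton]
  simp

/-- Coordinates outside `F` contribute equal factors to both weights. Those in `F` contribute at
most `1` on the left and at least `m ^ s` on the right. -/
lemma prod_mass_le {ι : Type*} [Fintype ι] (p : unitInterval) {m : ℝ} (hm : 0 < m)
    (hm1 : m ≤ 1) (hp : ∀ b, m ≤ mass p b) (F : Finset ι) (s : ℕ) (hF : F.card ≤ s)
    (ω ω' : ι → Bool) (h : ∀ i ∉ F, ω i = ω' i) :
    ∏ i, mass p (ω i) ≤ m⁻¹ ^ s * ∏ i, mass p (ω' i) := by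
  classical
  rw [← Finset.prod_mul_prod_compl F (fun i => mass p (ω i)),
    ← Finset.prod_mul_prod_compl F (fun i => mass p (ω' i))]
  have e : ∏ i ∈ Fᶜ, mass p (ω i) = ∏ i ∈ Fᶜ, mass p (ω' i) :=
    Finset.prod_congr rfl fun i hi => by rw [h i (by simpa using hi)]
  have h1 : ∏ i ∈ F, mass p (ω i) ≤ 1 :=
    Finset.prod_le_one (fun i _ => mass_nonneg _ _) fun i _ => mass_le_one _ _
  have h2 : m ^ s ≤ ∏ i ∈ F, mass p (ω' i) := by
    calc m ^ s ≤ m ^ F.card := pow_le_pow_of_le_one hm.le hm1 hF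
      _ ≤ _ := by
        rw [← Finset.prod_const]
        exact Finset.prod_le_prod (fun _ _ => hm.le) fun i _ => hp _
  have h3 : 0 ≤ ∏ i ∈ Fᶜ, mass p (ω' i) := Finset.prod_nonneg fun i _ => mass_nonneg _ _
  rw [e, ← mul_assoc]
  refine mul_le_mul_of_nonneg_right (h1.trans ?_) h3
  rw [inv_pow, inv_mul_eq_div, one_le_div (by positivity)]
  exact h2

lemma card_eq_off_le {ι : Type*} [Fintype ι] [DecidableEq ι] (F : Finset ι) (s : ℕ)
    (hF : F.card ≤ s) (ω' : ι → Bool) :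
    (Finset.univ.filter fun ω : ι → Bool => ∀ i ∉ F, ω i = ω' i).card ≤ 2 ^ s := by
  have h : (Finset.univ.filter fun ω : ι → Bool => ∀ i ∉ F, ω i = ω' i).card
      ≤ (Finset.univ : Finset (F → Bool)).card := by
    refine Finset.card_le_card_of_injOn (fun ω i => ω i)
      (fun _ _ => Finset.mem_coe.2 (Finset.mem_univ _)) ?_
    intro a ha b hb hab
    simp only [Finset.coe_filter, Finset.mem_univ, true_and, Set.mem_ofPred_eq] at ha hb
    funext i
    by_cases hi : i ∈ F
    · exact congrFun hab ⟨i, hi⟩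
    · rw [ha i hi, hb i hi]
  refine h.trans ?_
  simp only [Finset.card_univ, Fintype.card_fun, Fintype.card_bool, Fintype.card_coe]
  exact Nat.pow_le_pow_right (by norm_num) hF

/-- Multivalued local modification: if every `ω ∈ A` can be modified in at least `t` ways, each
on a set of at most `s` coordinates that is determined by the result, so as to land in `D`,
then `A` has small probability compared to `D`. -/
theorem mul_bern_real_le_of_modification {ι κ : Type*} [Fintype ι] (p : unitInterval) {m : ℝ}
    (hm : 0 < m) (hm1 : m ≤ 1) (hp : ∀ b, m ≤ mass p b) (s t : ℕ) (F : κ → Finset ι)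
    (A D : Set (ι → Bool)) (c : (ι → Bool) → κ) (hF : ∀ ω ∈ D, (F (c ω)).card ≤ s)
    (h : ∀ ω ∈ A, ∃ Z : Finset κ, t ≤ Z.card ∧
      ∀ z ∈ Z, ∃ ω' ∈ D, c ω' = z ∧ ∀ i ∉ F z, ω i = ω' i) :
    t * (bern ι p).real A ≤ (2 * m⁻¹) ^ s * (bern ι p).real D := by
  classical
  set w : (ι → Bool) → ℝ := fun ω => ∏ i, mass p (ω i) with hw
  have hw0 : ∀ ω, 0 ≤ w ω := fun ω => Finset.prod_nonneg fun i _ => mass_nonneg _ _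
  rw [bern_real_eq_sum, bern_real_eq_sum]
  have key : ∀ ω ∈ A, t * w ω ≤ ∑ ω' with ω' ∈ D,
      if ∀ i ∉ F (c ω'), ω i = ω' i then m⁻¹ ^ s * w ω' else 0 := by
    intro ω hω
    obtain ⟨Z, hZ, hz⟩ := h ω hω
    choose! g hgD hgc hg using hz
    -- The label `c` tells the images of `ω` apart.
    have hinj : Set.InjOn g Z := fun a ha b hb hab => by
      rw [← hgc a ha, ← hgc b hb, hab]
    calc (t : ℝ) * w ω ≤ Z.card * w ω := by
          gcongr; exact hw0 ω
      _ = ∑ z ∈ Z, w ω := by simp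
      _ ≤ ∑ z ∈ Z, m⁻¹ ^ s * w (g z) := by
          refine Finset.sum_le_sum fun z hz => ?_
          exact prod_mass_le p hm hm1 hp (F z) s (hgc z hz ▸ hF _ (hgD z hz)) ω (g z) (hg z hz)
      _ = ∑ ω' ∈ Z.image g, m⁻¹ ^ s * w ω' := by
          rw [Finset.sum_image hinj]
      _ = ∑ ω' ∈ Z.image g, if ∀ i ∉ F (c ω'), ω i = ω' i then m⁻¹ ^ s * w ω' else 0 := by
          refine Finset.sum_congr rfl fun ω' h' => ?_
          obtain ⟨z, hz, rfl⟩ := Finset.mem_image.1 h'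
          rw [if_pos]
          rw [hgc z hz]; exact hg z hz
      _ ≤ _ := by
          refine Finset.sum_le_sum_of_subset_of_nonneg ?_ ?_
          · intro ω' h'
            obtain ⟨z, hz, rfl⟩ := Finset.mem_image.1 h'
            simpa using hgD z hz
          · intro ω' _ _
            split_ifs
            · exact mul_nonneg (by positivity) (hw0 _)
            · exact le_rfl
  calc t * ∑ ω with ω ∈ A, w ω = ∑ ω with ω ∈ A, t * w ω := Finset.mul_sum _ _ _
    _ ≤ ∑ ω with ω ∈ A, ∑ ω' with ω' ∈ D,
      (if ∀ i ∉ F (c ω'), ω i = ω' i then m⁻¹ ^ s * w ω' else 0) :=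
        Finset.sum_le_sum fun ω hω => key ω (by simpa using hω)
    _ = ∑ ω' with ω' ∈ D, ∑ ω with ω ∈ A,
      (if ∀ i ∉ F (c ω'), ω i = ω' i then m⁻¹ ^ s * w ω' else 0) := Finset.sum_comm
    -- A preimage of `ω'` agrees with it off `F (c ω')`, a set known from `ω'` alone, so there are
    -- at most `2 ^ s` of them.
    _ ≤ ∑ ω' with ω' ∈ D, (2 * m⁻¹) ^ s * w ω' := by
        refine Finset.sum_le_sum fun ω' hD => ?_
        rw [← Finset.sum_filter, Finset.sum_const, nsmul_eq_mul, mul_pow, mul_assoc]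
        refine mul_le_mul_of_nonneg_right ?_ (mul_nonneg (by positivity) (hw0 _))
        have := card_eq_off_le (F (c ω')) s (hF ω' (by simpa using hD)) ω'
        have h2 := (Finset.card_le_card (Finset.filter_subset_filter
          (fun ω : ι → Bool => ∀ i ∉ F (c ω'), ω i = ω' i)
          (Finset.subset_univ (Finset.univ.filter (· ∈ A))))).trans this
        exact_mod_cast h2
    _ = _ := (Finset.mul_sum _ _ _).symm

/-! ### Reachability within a set, and paths as lists. -/

open Relation

/-- `y` can be reached from `x` by steps of `r` between elements of `A`. -/
def ReachIn {V : Type*} (r : V → V → Prop) (A : Set V) (x y : V) : Prop :=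
  x ∈ A ∧ ReflTransGen (fun v w => r v w ∧ v ∈ A ∧ w ∈ A) x y

namespace ReachIn

variable {V : Type*} {r r' : V → V → Prop} {A A' : Set V} {x y z : V}

lemma refl (h : x ∈ A) : ReachIn r A x x := ⟨h, .refl⟩

lemma left_mem (h : ReachIn r A x y) : x ∈ A := h.1

lemma right_mem (h : ReachIn r A x y) : y ∈ A := by
  obtain ⟨hx, h⟩ := h
  induction h with
  | refl => exact hx
  | tail _ h _ => exact h.2.2

lemma tail (h : ReachIn r A x y) (hr : r y z) (hz : z ∈ A) : ReachIn r A x z :=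
  ⟨h.1, h.2.tail ⟨hr, h.right_mem, hz⟩⟩

lemma trans (h : ReachIn r A x y) (h' : ReachIn r A y z) : ReachIn r A x z :=
  ⟨h.1, h.2.trans h'.2⟩

lemma mono (h : ReachIn r A x y) (hr : ∀ v ∈ A, ∀ w ∈ A, r v w → r' v w) (hA : A ⊆ A') :
    ReachIn r' A' x y :=
  ⟨hA h.1, ReflTransGen.mono (fun v w ⟨h1, h2, h3⟩ => ⟨hr v h2 w h3 h1, hA h2, hA h3⟩) _ _ h.2⟩

lemma symm (hr : ∀ v w, r v w → r w v) (h : ReachIn r A x y) : ReachIn r A y x := by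
  refine ⟨h.right_mem, ?_⟩
  have := h.2
  clear h
  induction this with
  | refl => exact .refl
  | tail _ h ih => exact .head ⟨hr _ _ h.1, h.2.2, h.2.1⟩ ih

/-- A property that holds at the start and is preserved by steps holds at the end. -/
lemma induct {p : V → Prop} (h : ReachIn r A x y) (h0 : p x)
    (hs : ∀ v ∈ A, ∀ w ∈ A, r v w → p v → p w) : p y := by
  obtain ⟨hx, h⟩ := h
  induction h with
  | refl => exact h0
  | tail _ h ih => exact hs _ h.2.1 _ h.2.2 h.1 ih

end ReachIn

/-- Loop erasure, built from the end: if the vertex to be prepended already occurs, drop everything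
before that occurrence. -/
lemma exists_nodup_isChain {V : Type*} {r : V → V → Prop} {a b : V} (h : ReflTransGen r a b) :
    ∃ l : List V, (a :: l).IsChain r ∧ (a :: l).Nodup ∧ (a :: l).getLast? = some b := by
  induction h using ReflTransGen.head_induction_on with
  | refl => exact ⟨[], by simp⟩
  | @head a c hac _ ih =>
    obtain ⟨l, h1, h2, h3⟩ := ih
    by_cases ha : a ∈ c :: l
    · obtain ⟨s, t, hst⟩ := List.append_of_mem ha
      rw [hst] at h1 h2 h3
      refine ⟨t, (List.isChain_split.1 h1).2, (List.nodup_append.1 h2).2.1, ?_⟩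
      rw [← h3]; simp [List.getLast?_append, List.getLast?_cons]
    · refine ⟨c :: l, List.IsChain.cons_cons hac h1, List.nodup_cons.2 ⟨ha, h2⟩, ?_⟩
      rw [← h3]; simp [List.getLast?_cons]

lemma exists_first_difference {V : Type*} : ∀ a b : List V, (∀ x s, b ≠ a ++ x :: s) →
    (∀ x s, a ≠ b ++ x :: s) → a ≠ b →
    ∃ l x y s t, x ≠ y ∧ a = l ++ x :: s ∧ b = l ++ y :: t
  | [], [], _, _, h => (h rfl).elim
  | [], y :: t, h, _, _ => (h y t rfl).elim
  | x :: s, [], _, h, _ => (h x s rfl).elim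
  | x :: s, y :: t, h1, h2, h3 => by
    by_cases hxy : x = y
    · subst hxy
      obtain ⟨l, x', y', s', t', hne, ha, hb⟩ := exists_first_difference s t
        (fun x' s' h => h1 x' s' (by rw [h]; rfl)) (fun x' s' h => h2 x' s' (by rw [h]; rfl))
        (fun h => h3 (by rw [h]))
      exact ⟨x :: l, x', y', s', t', hne, by rw [ha]; rfl, by rw [hb]; rfl⟩
    · exact ⟨[], x, y, s, t, hxy, rfl, rfl⟩

lemma exists_first_mem {V : Type*} (p : V → Prop) : ∀ s : List V, (∀ v ∈ s, ¬ p v) ∨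
    ∃ r h t, s = r ++ h :: t ∧ p h ∧ ∀ v ∈ r, ¬ p v
  | [] => .inl (by simp)
  | x :: s => by
    by_cases hx : p x
    · exact .inr ⟨[], x, s, rfl, hx, by simp⟩
    · rcases exists_first_mem p s with h | ⟨r, h, t, e, hh, hr⟩
      · left; intro v hv
        rcases List.mem_cons.1 hv with rfl | hv
        · exact hx
        · exact h v hv
      · refine .inr ⟨x :: r, h, t, by rw [e]; rfl, hh, ?_⟩
        intro v hv
        rcases List.mem_cons.1 hv with rfl | hv
        · exact hx
        · exact hr v hv

lemma isChain_imp_of_mem {V : Type*} {r r' : V → V → Prop} {p : V → Prop} {l : List V}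
    (h : l.IsChain r) (hp : ∀ v ∈ l, p v) (himp : ∀ v w, p v → p w → r v w → r' v w) :
    l.IsChain r' := by
  induction h with
  | nil => exact .nil
  | singleton => exact .singleton _
  | cons_cons hr _ ih =>
    refine .cons_cons (himp _ _ (hp _ (by simp)) (hp _ (by simp)) hr) (ih fun v hv => ?_)
    exact hp v (List.mem_cons_of_mem _ hv)

lemma rel_of_infix {V : Type*} {r : V → V → Prop} {l : List V} (h : l.IsChain r) {a b : V}
    (hab : [a, b] <:+: l) : r a b := by
  have := h.infix hab
  simpa using this

lemma infix_right_unique {V : Type*} {l : List V} (hl : l.Nodup) {a b c : V}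
    (hb : [a, b] <:+: l) (hc : [a, c] <:+: l) : b = c := by
  obtain ⟨s, t, rfl⟩ := hb
  obtain ⟨s', t', h⟩ := hc
  have e : s' ++ a :: (c :: t') = s ++ a :: (b :: t) := by simpa using h
  have hnd : (s ++ a :: (b :: t)).Nodup := by simpa using hl
  have hnd' := hnd
  rw [← e] at hnd'
  have h1 : a ∉ s := fun hs => (List.nodup_append.1 hnd).2.2 a hs a (by simp) rfl
  have h2 : a ∉ s' := fun hs => (List.nodup_append.1 hnd').2.2 a hs a (by simp) rfl
  induction s generalizing s' with
  | nil =>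
    cases s' with
    | nil => simp at e; exact e.1.symm
    | cons x s' => simp at e; exact (h2 (by simp [e.1])).elim
  | cons x s ih =>
    cases s' with
    | nil => simp at e; exact (h1 (by simp [e.1])).elim
    | cons x' s' =>
      simp only [List.cons_append, List.cons.injEq] at e
      refine ih ?_ s' ?_ e.2 ?_ ?_ ?_ ?_
      · have := hl; simp only [List.cons_append] at this; exact (List.nodup_cons.1 this).2
      · simpa using e.2
      · exact (List.nodup_cons.1 (by simpa only [List.cons_append] using hnd)).2
      · rw [e.2]; exact (List.nodup_cons.1 (by simpa only [List.cons_append] using hnd)).2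
      · exact fun h => h1 (List.mem_cons_of_mem _ h)
      · exact fun h => h2 (List.mem_cons_of_mem _ h)

/-! ### The minimal crossing path for random preferences. -/

/-- A graph projected onto columns, with the regions entering the gluing lemma. -/
structure Setup (V P : Type*) where
  /-- The graph. -/
  G : SimpleGraph V
  /-- The column of a vertex. -/
  col : V → P
  /-- The region of the first path. -/
  B₁ : Set V
  /-- The region of the second pair of paths. -/
  B₂ : Set V
  /-- The start of the first path. -/
  S : Set V
  /-- The target of the first path. -/
  T : Set V
  /-- The start of the second pair of paths. -/
  S' : Set V
  /-- The target of the lower path. -/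
  Ym : Set V
  /-- The target of the upper path. -/
  Yp : Set V

/-- Coordinates: the edges, and for every ordered pair a preference bit. -/
abbrev Coord (V : Type*) : Type _ := Sym2 V ⊕ (V × V)

/-- States of the edges together with the preference bits. -/
abbrev State (V : Type*) : Type _ := Coord V → Bool

/-- The preference rank of `x` as a successor of `v`. -/
noncomputable def rank {V : Type*} [Fintype V] (η : State V) (v x : V) : ℕ :=
  (if η (.inr (v, x)) = true then 0 else Fintype.card V) + Fintype.equivFin V x

/-- The preference rank of `x` as an element following the list `l`. -/
noncomputable def prio {V : Type*} [Fintype V] (η : State V) (l : List V) (x : V) : ℕ :=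
  match l.getLast? with
  | none => Fintype.equivFin V x
  | some v => rank η v x

/-- The ranks of a list whose predecessor is `a`. -/
noncomputable def codeFrom {V : Type*} [Fintype V] (η : State V) : V → List V → List ℕ
  | _, [] => []
  | a, b :: t => rank η a b :: codeFrom η b t

/-- The list of the ranks of a list. -/
noncomputable def code {V : Type*} [Fintype V] (η : State V) : List V → List ℕ
  | [] => []
  | a :: t => (Fintype.equivFin V a : ℕ) :: codeFrom η a t

section rank

variable {V : Type*} [Fintype V] (η : State V)

/-- A true bit puts the rank in `[0, N)` and a false bit in `[N, 2N)`, with `N` the number of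
vertices. Within each block the rank follows a fixed enumeration. -/
lemma rank_injective (v : V) : Function.Injective (rank η v) := by
  intro x y h
  unfold rank at h
  have hx := (Fintype.equivFin V x).2
  have hy := (Fintype.equivFin V y).2
  refine (Fintype.equivFin V).injective (Fin.ext ?_)
  split_ifs at h <;> omega

lemma prio_injective (l : List V) : Function.Injective (prio η l) := by
  intro x y h
  unfold prio at h
  cases hl : l.getLast? with
  | none => rw [hl] at h; exact (Fintype.equivFin V).injective (Fin.ext h)
  | some v => rw [hl] at h; exact rank_injective η v h

@[simp] lemma prio_nil (x : V) : prio η [] x = Fintype.equivFin V x := rfl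

@[simp] lemma prio_concat (l : List V) (v x : V) : prio η (l ++ [v]) x = rank η v x := by
  simp [prio]

lemma codeFrom_append (a : V) (l : List V) (x : V) (s : List V) :
    codeFrom η a (l ++ x :: s) = codeFrom η a l ++ prio η (a :: l) x :: codeFrom η x s := by
  induction l generalizing a with
  | nil => rfl
  | cons b l ih => simp [codeFrom, ih, prio, List.getLast?_cons]

lemma code_append (l : List V) (x : V) (s : List V) :
    code η (l ++ x :: s) = code η l ++ prio η l x :: codeFrom η x s := by
  cases l with
  | nil => rfl
  | cons a l => simp [code, codeFrom_append]

lemma code_lt {l : List V} {x y : V} (h : prio η l x < prio η l y) (s t : List V) :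
    code η (l ++ x :: s) < code η (l ++ y :: t) := by
  rw [code_append, code_append]
  induction code η l with
  | nil => exact List.Lex.rel h
  | cons a l ih => exact List.Lex.cons ih

end rank

namespace Setup

variable {V P : Type*} (D : Setup V P)

/-- The edge `vw` is open. -/
def Opn (η : State V) (v w : V) : Prop := D.G.Adj v w ∧ η (.inl s(v, w)) = true

lemma Opn.symm {D : Setup V P} {η : State V} {v w : V} (h : D.Opn η v w) : D.Opn η w v :=
  ⟨h.1.symm, by rw [Sym2.eq_swap]; exact h.2⟩

/-- An open step in `B₁` that does not enter `S` and does not leave `T`. -/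
def Step (η : State V) (v w : V) : Prop :=
  D.Opn η v w ∧ v ∈ D.B₁ ∧ w ∈ D.B₁ ∧ w ∉ D.S ∧ v ∉ D.T

/-- `γ` is a simple open path in `B₁` from `S` to `T`, meeting `S` only at its start and `T` only
at its end. -/
structure Crosses (η : State V) (γ : List V) : Prop where
  chain : γ.IsChain (D.Step η)
  nodup : γ.Nodup
  head : ∃ a t, γ = a :: t ∧ a ∈ D.S ∧ a ∈ D.B₁
  last : ∃ b, γ.getLast? = some b ∧ b ∈ D.T

/-- Some open path within `A` joins `X` to `Y`. -/
def Joins (η : State V) (A X Y : Set V) : Prop :=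
  ∃ x ∈ X, ∃ y ∈ Y, ReachIn (D.Opn η) A x y

/-- Keep the piece of the path from its last visit to `S` up to the first later visit to `T`, then
erase loops. -/
lemma exists_crosses {η : State V} (h : D.Joins η D.B₁ D.S D.T) : ∃ γ, D.Crosses η γ := by
  obtain ⟨x, hx, y, hy, hxy⟩ := h
  have hy1 := hxy.right_mem
  have key : (∃ a ∈ D.S, a ∈ D.B₁ ∧ ∃ t ∈ D.T, ReflTransGen (D.Step η) a t) ∨
      ∃ t ∈ D.T, ReflTransGen (D.Step η) x t := by
    have h := hxy.2
    clear hx hxy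
    induction h using ReflTransGen.head_induction_on with
    | refl => exact .inr ⟨y, hy, .refl⟩
    | @head v w hvw _ ih =>
      rcases ih with h | ⟨t, ht, hwt⟩
      · exact .inl h
      · by_cases hv : v ∈ D.T
        · exact .inr ⟨v, hv, .refl⟩
        · by_cases hw : w ∈ D.S
          · exact .inl ⟨w, hw, hvw.2.2, t, ht, hwt⟩
          · exact .inr ⟨t, ht, .head ⟨hvw.1, hvw.2.1, hvw.2.2, hw, hv⟩ hwt⟩
  have key' : ∃ a ∈ D.S, a ∈ D.B₁ ∧ ∃ t ∈ D.T, ReflTransGen (D.Step η) a t := by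
    rcases key with h | h
    · exact h
    · exact ⟨x, hx, hxy.left_mem, h⟩
  obtain ⟨a, ha, ha1, t, ht, hat⟩ := key'
  obtain ⟨l, h1, h2, h3⟩ := exists_nodup_isChain hat
  exact ⟨a :: l, h1, h2, ⟨a, l, rfl, ha, ha1⟩, ⟨t, h3, ht⟩⟩

namespace Crosses

variable {D} {η : State V} {γ : List V}

lemma mem_B₁ (h : D.Crosses η γ) {v : V} (hv : v ∈ γ) : v ∈ D.B₁ := by
  obtain ⟨s, t, rfl⟩ := List.append_of_mem hv
  rcases List.eq_nil_or_concat s with rfl | ⟨s, u, rfl⟩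
  · obtain ⟨a, t', e, _, ha⟩ := h.head
    simp at e; rw [e.1]; exact ha
  · have : D.Step η u v := rel_of_infix h.chain ⟨s, t, by simp⟩
    exact this.2.2.1

lemma not_mem_S_of_append (h : D.Crosses η γ) {l : List V} {v : V} {t : List V}
    (e : γ = l ++ v :: t) (hl : l ≠ []) : v ∉ D.S := by
  rcases List.eq_nil_or_concat l with rfl | ⟨s, u, rfl⟩
  · exact (hl rfl).elim
  · have : D.Step η u v := rel_of_infix h.chain ⟨s, t, by simp [e]⟩
    exact this.2.2.2.1

/-- A crossing ends in `T`, and no step leaves `T`. Hence two distinct crossings always have a first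
position where they differ, which is where they are compared. -/
lemma not_prefix {σ : List V} (h : D.Crosses η γ) (h' : D.Crosses η σ) (x : V) (s : List V) :
    σ ≠ γ ++ x :: s := by
  rintro rfl
  obtain ⟨b, hb, hbT⟩ := h.last
  rcases List.eq_nil_or_concat γ with rfl | ⟨l, u, rfl⟩
  · simp at hb
  · simp at hb; subst hb
    have : D.Step η u x := rel_of_infix h'.chain ⟨l, s, by simp⟩
    exact this.2.2.2.2 hbT

lemma reach (h : D.Crosses η γ) {v : V} (hv : v ∈ γ) :
    ∃ a ∈ D.S, ReachIn (D.Opn η) Set.univ a v := by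
  obtain ⟨a, t, rfl, ha, ha1⟩ := h.head
  refine ⟨a, ha, ⟨trivial, ?_⟩⟩
  have hc := h.chain
  clear h ha ha1
  induction t generalizing a with
  | nil => simp at hv; subst hv; exact .refl
  | cons b t ih =>
    rcases List.mem_cons.1 hv with rfl | hv
    · exact .refl
    · rw [List.isChain_cons_cons] at hc
      exact .head ⟨hc.1.1, trivial, trivial⟩ (ih b hv hc.2)

end Crosses

/-- `γ` is the lexicographically minimal crossing path. -/
def IsMin [Fintype V] (η : State V) (γ : List V) : Prop :=
  D.Crosses η γ ∧ ∀ l x y s g, γ = l ++ y :: g → D.Crosses η (l ++ x :: s) →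
    prio η l y ≤ prio η l x

/-- Simple paths have bounded length, so there are finitely many crossings and one minimises `code`
lexicographically. A better vertex at any position would lower the code. -/
lemma exists_isMin [Fintype V] {η : State V} (h : D.Joins η D.B₁ D.S D.T) :
    ∃ γ, D.IsMin η γ := by
  classical
  have hfin : {γ | D.Crosses η γ}.Finite :=
    (List.finite_length_le V (Fintype.card V)).subset fun γ hγ => hγ.nodup.length_le_card
  obtain ⟨γ, hγ, hmin⟩ := Set.exists_min_image _ (code η) hfin (D.exists_crosses h)
  refine ⟨γ, hγ, fun l x y s g e hx => ?_⟩
  by_contra hlt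
  rw [not_le] at hlt
  have := hmin _ hx
  rw [e] at this
  exact absurd (code_lt η hlt s g) (not_lt.2 this)

variable {D}

lemma IsMin.unique [Fintype V] {η : State V} {γ σ : List V} (h : D.IsMin η γ)
    (h' : D.IsMin η σ) : γ = σ := by
  by_contra hne
  obtain ⟨l, x, y, s, t, hxy, rfl, rfl⟩ := exists_first_difference γ σ
    (fun x s => h.1.not_prefix h'.1 x s) (fun x s => h'.1.not_prefix h.1 x s) hne
  exact hxy (prio_injective η l (le_antisymm (h.2 _ _ _ _ _ rfl h'.1) (h'.2 _ _ _ _ _ rfl h.1)))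

/-- Closing edges outside the minimal path leaves it minimal. -/
lemma IsMin.of_le [Fintype V] {η η' : State V} {γ : List V} (h : D.IsMin η γ)
    (hle : ∀ e, η' (.inl e) = true → η (.inl e) = true) (hb : ∀ d, η' (.inr d) = η (.inr d))
    (hγ : ∀ a b, [a, b] <:+: γ → η' (.inl s(a, b)) = true) : D.IsMin η' γ := by
  have hr : ∀ v x, rank η' v x = rank η v x := fun v x => by simp [rank, hb]
  have hp : ∀ l x, prio η' l x = prio η l x := fun l x => by
    unfold prio; split
    · rfl
    · exact hr _ _
  have hcr : ∀ σ, D.Crosses η' σ → D.Crosses η σ := fun σ hσ =>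
    ⟨hσ.chain.imp fun v w hvw => ⟨⟨hvw.1.1, hle _ hvw.1.2⟩, hvw.2⟩, hσ.nodup, hσ.head, hσ.last⟩
  refine ⟨⟨?_, h.1.nodup, h.1.head, h.1.last⟩, fun l x y s g e hx => ?_⟩
  · rw [List.isChain_iff_forall_rel_of_append_cons_cons]
    intro a b l₁ l₂ e
    have hi : [a, b] <:+: γ := ⟨l₁, l₂, by simp [e]⟩
    have := rel_of_infix h.1.chain hi
    exact ⟨⟨this.1.1, hγ a b hi⟩, this.2⟩
  · rw [hp, hp]
    exact h.2 l x y s g e (hcr _ hx)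

variable (D)

open Classical in
/-- The minimal crossing path, or the empty list if there is none. -/
noncomputable def minPath [Fintype V] (η : State V) : List V :=
  if h : ∃ γ, D.IsMin η γ then h.choose else []

variable {D}

lemma IsMin.minPath_eq [Fintype V] {η : State V} {γ : List V} (h : D.IsMin η γ) :
    D.minPath η = γ := by
  have h' : ∃ γ, D.IsMin η γ := ⟨γ, h⟩
  rw [minPath, dif_pos h']
  exact h'.choose_spec.unique h

end Setup

/-! ### Surgery in one column keeps the minimal path. -/

namespace Setup

variable {V P : Type*} (D : Setup V P)

open Classical in
/-- Keep `γ`, open `s(w', w)` and the edges inside the column `z` that do not join vertices of `γ`,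
close all other edges meeting the column `z`, and make the darts of `γ` preferred there. -/
noncomputable def surgery (η : State V) (γ : List V) (z : P) (w w' : V) : State V
  | .inl e => if e ∈ D.G.edgeSet ∧ ∃ v ∈ e, D.col v = z then
      decide ((∃ a b, [a, b] <:+: γ ∧ e = s(a, b)) ∨ e = s(w', w) ∨
        ((∀ v ∈ e, D.col v = z) ∧ ∃ v ∈ e, v ∉ γ)) else η (.inl e)
  | .inr (v, x) => if D.col v = z ∧ D.G.Adj v x then decide ([v, x] <:+: γ) else η (.inr (v, x))

lemma surgery_inl_iff (η : State V) (γ : List V) (z : P) (w w' : V) {e : Sym2 V}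
    (he : e ∈ D.G.edgeSet) (hz : ∃ v ∈ e, D.col v = z) :
    D.surgery η γ z w w' (.inl e) = true ↔ (∃ a b, [a, b] <:+: γ ∧ e = s(a, b)) ∨
      e = s(w', w) ∨ ((∀ v ∈ e, D.col v = z) ∧ ∃ v ∈ e, v ∉ γ) := by
  simp only [surgery]
  rw [if_pos ⟨he, hz⟩]
  exact @decide_eq_true_iff _ (_)

/-- The hypotheses under which the surgery is performed. -/
structure Glueable [Fintype V] (η : State V) (γ : List V) (z : P) (w w' : V) : Prop where
  isMin : D.IsMin η γ
  not_joins : ¬ D.Joins η Set.univ D.S D.S'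
  exists_mem : ∃ g ∈ γ, D.col g = z
  not_S : ∀ v ∈ D.S, D.col v ≠ z
  adj : D.G.Adj w' w
  col_eq : D.col w' = z
  reach : ∃ s ∈ D.S', ReachIn (D.Opn η) {v | ∀ g ∈ γ, D.col g ≠ D.col v} s w

namespace Glueable

variable {D} [Fintype V] {η : State V} {γ : List V} {z : P} {w w' : V}

/-- The cluster of `S'`. -/
def cluster (D : Setup V P) (η : State V) : Set V :=
  {x | ∃ s ∈ D.S', ReachIn (D.Opn η) Set.univ s x}

omit [Fintype V] in
lemma cluster_of_opn {x y : V} (hx : x ∈ cluster D η) (h : D.Opn η x y) : y ∈ cluster D η := by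
  obtain ⟨s, hs, hsx⟩ := hx
  exact ⟨s, hs, hsx.tail h trivial⟩

variable (h : D.Glueable η γ z w w')
include h

lemma not_mem_cluster {x : V} (hx : x ∈ γ) : x ∉ cluster D η := by
  rintro ⟨s, hs, hsx⟩
  obtain ⟨a, ha, hax⟩ := h.isMin.1.reach hx
  exact h.not_joins ⟨a, ha, s, hs, hax.trans (hsx.symm fun _ _ h => h.symm)⟩

lemma S_not_mem_cluster {x : V} (hx : x ∈ D.S) : x ∉ cluster D η := by
  rintro ⟨s, hs, hsx⟩
  exact h.not_joins ⟨x, hx, s, hs, hsx.symm fun _ _ h => h.symm⟩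

lemma w_mem_cluster : w ∈ cluster D η := by
  obtain ⟨s, hs, hsw⟩ := h.reach
  exact ⟨s, hs, hsw.mono (fun _ _ _ _ h => h) (Set.subset_univ _)⟩

lemma col_ne_of_off {v : V} (hv : ∀ g ∈ γ, D.col g ≠ D.col v) : D.col v ≠ z := by
  obtain ⟨g, hg, rfl⟩ := h.exists_mem
  exact (hv g hg).symm

lemma w_not_mem : w ∉ γ := fun hw => by
  obtain ⟨s, _, hsw⟩ := h.reach
  exact hsw.right_mem w hw rfl

omit [Fintype V] h in
lemma opn_iff_of_col_ne {v x : V} (hv : D.col v ≠ z) (hx : D.col x ≠ z) :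
    D.Opn (D.surgery η γ z w w') v x ↔ D.Opn η v x := by
  unfold Opn surgery
  simp [hv, hx]

omit [Fintype V] h in
lemma opn_cases {v x : V} (ho : D.Opn (D.surgery η γ z w w') v x)
    (hz : D.col v = z ∨ D.col x = z) :
    ([v, x] <:+: γ ∨ [x, v] <:+: γ) ∨ (v = w' ∧ x = w ∨ v = w ∧ x = w') ∨
      (D.col v = z ∧ D.col x = z ∧ (v ∉ γ ∨ x ∉ γ)) := by
  obtain ⟨ha, ho⟩ := ho
  rw [surgery_inl_iff _ _ _ _ _ _ ha (by simpa using hz)] at ho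
  rcases ho with ⟨a, b, hab, e⟩ | e | ⟨h1, h2⟩
  · left
    rcases Sym2.eq_iff.1 e with ⟨rfl, rfl⟩ | ⟨rfl, rfl⟩
    · exact .inl hab
    · exact .inr hab
  · right; left
    exact Sym2.eq_iff.1 e
  · right; right
    simpa [and_assoc] using And.intro h1 h2

omit [Fintype V] h in
lemma mem_of_infix {a b : V} (hab : [a, b] <:+: γ) : a ∈ γ ∧ b ∈ γ :=
  ⟨hab.subset (by simp), hab.subset (by simp)⟩

/-- The vertices that the surgery attaches to the minimal path. -/
def new (D : Setup V P) (η : State V) (γ : List V) (z : P) : Set V :=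
  {v | v ∉ γ ∧ D.col v = z} ∪ cluster D η

lemma not_mem_new {v : V} (hv : v ∈ γ) : v ∉ new D η γ z := by
  rintro (h' | h')
  · exact h'.1 hv
  · exact h.not_mem_cluster hv h'

lemma opn_of_not_mem_new {v x : V} (ho : D.Opn (D.surgery η γ z w w') v x)
    (hv : v ∉ new D η γ z) (hx : x ∉ new D η γ z) : D.Opn η v x := by
  by_cases hz : D.col v = z ∨ D.col x = z
  · rcases opn_cases ho hz with (hi | hi) | (⟨rfl, rfl⟩ | ⟨rfl, rfl⟩) | ⟨h1, h2, h3 | h3⟩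
    · exact (rel_of_infix h.isMin.1.chain hi).1
    · exact (rel_of_infix h.isMin.1.chain hi).1.symm
    · exact (hx (.inr h.w_mem_cluster)).elim
    · exact (hv (.inr h.w_mem_cluster)).elim
    · exact (hv (.inl ⟨h3, h1⟩)).elim
    · exact (hx (.inl ⟨h3, h2⟩)).elim
  · rw [not_or] at hz
    exact (opn_iff_of_col_ne hz.1 hz.2).1 ho

/-- Outside the column `z`, no vertex of the path has a neighbour among the new vertices. -/
lemma not_mem_new_of_opn {g x : V} (hg : g ∈ γ) (hgz : D.col g ≠ z)
    (ho : D.Opn (D.surgery η γ z w w') g x) : x ∉ new D η γ z := by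
  intro hx
  by_cases hz : D.col x = z
  · rcases opn_cases ho (.inr hz) with (hi | hi) | (⟨rfl, rfl⟩ | ⟨rfl, rfl⟩) | ⟨h1, _⟩
    · exact h.not_mem_new (mem_of_infix hi).2 hx
    · exact h.not_mem_new (mem_of_infix hi).1 hx
    · exact hgz h.col_eq
    · exact h.w_not_mem hg
    · exact hgz h1
  · rcases hx with hx | hx
    · exact hz hx.2
    · have ho' := (opn_iff_of_col_ne hgz hz).1 ho
      exact h.not_mem_cluster hg (cluster_of_opn hx ho'.symm)

/-- With `not_mem_new_of_opn`, this says that new vertices communicate with the others only through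
`γ` inside the column `z`. Off `γ`, the only open edge leaving the column is the bridge, whose far
end `w` is in the cluster of `S'`; elsewhere that cluster is closed under open steps. -/
lemma not_mem_new_of_opn' {x y : V} (hx : x ∉ γ) (hxn : x ∉ new D η γ z)
    (ho : D.Opn (D.surgery η γ z w w') x y) : y ∉ new D η γ z := by
  intro hy
  have hxz : D.col x ≠ z := fun e => hxn (.inl ⟨hx, e⟩)
  have hxc : x ∉ cluster D η := fun e => hxn (.inr e)
  by_cases hz : D.col y = z
  · rcases opn_cases ho (.inr hz) with (hi | hi) | (⟨rfl, rfl⟩ | ⟨rfl, rfl⟩) | ⟨h1, _⟩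
    · exact hx (mem_of_infix hi).1
    · exact hx (mem_of_infix hi).2
    · exact hxz h.col_eq
    · exact hxc h.w_mem_cluster
    · exact hxz h1
  · rcases hy with hy | hy
    · exact hz hy.2
    · exact hxc (cluster_of_opn hy ((opn_iff_of_col_ne hxz hz).1 ho).symm)

lemma opn_of_infix {a b : V} (hi : [a, b] <:+: γ) : D.Opn (D.surgery η γ z w w') a b := by
  have ho := (rel_of_infix h.isMin.1.chain hi).1
  by_cases hz : D.col a = z ∨ D.col b = z
  · refine ⟨ho.1, ?_⟩
    rw [surgery_inl_iff _ _ _ _ _ _ ho.1 (by simpa using hz)]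
    exact .inl ⟨a, b, hi, rfl⟩
  · rw [not_or] at hz
    exact (opn_iff_of_col_ne hz.1 hz.2).2 ho

lemma opn_bridge : D.Opn (D.surgery η γ z w w') w' w := by
  refine ⟨h.adj, ?_⟩
  rw [surgery_inl_iff _ _ _ _ _ _ h.adj ⟨w', by simp, h.col_eq⟩]
  exact .inr (.inl rfl)

omit [Fintype V] h in
lemma opn_column {v x : V} (ha : D.G.Adj v x) (hv : D.col v = z) (hx : D.col x = z)
    (hg : v ∉ γ) : D.Opn (D.surgery η γ z w w') v x := by
  refine ⟨ha, ?_⟩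
  rw [surgery_inl_iff _ _ _ _ _ _ ha ⟨v, by simp, hv⟩]
  exact .inr (.inr ⟨by simp [hv, hx], v, by simp, hg⟩)

lemma crosses_of_not_mem_new {σ : List V} (hσ : D.Crosses (D.surgery η γ z w w') σ)
    (hn : ∀ v ∈ σ, v ∉ new D η γ z) : D.Crosses η σ :=
  ⟨isChain_imp_of_mem hσ.chain hn fun _ _ hv hx hr => ⟨h.opn_of_not_mem_new hr.1 hv hx, hr.2⟩,
    hσ.nodup, hσ.head, hσ.last⟩

omit [Fintype V] h in
lemma not_mem_of_isChain {r : V → V → Prop} {N : Set V} {γ : List V}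
    (hN : ∀ x y, x ∉ γ → x ∉ N → r x y → y ∉ N) :
    ∀ {l : List V}, l.IsChain r → (∀ v ∈ l, v ∉ γ) → (∀ x s, l = x :: s → x ∉ N) →
      ∀ v ∈ l, v ∉ N := by
  intro l hl
  induction hl with
  | nil => simp
  | singleton a => intro _ h v hv; simp at hv; subst hv; exact h _ _ rfl
  | @cons_cons a b l hab _ ih =>
    intro hγ hx v hv
    have ha := hx _ _ rfl
    rcases List.mem_cons.1 hv with rfl | hv
    · exact ha
    · refine ih (fun v hv => hγ v (List.mem_cons_of_mem _ hv)) ?_ v hv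
      rintro x s ⟨⟩
      exact hN _ _ (hγ _ (by simp)) ha hab

/-- A better crossing in the modified state yields a better one in `η`. Inside the column `z` the
darts of `γ` are preferred, so the competitor diverges from `γ` elsewhere or at its first vertex,
and hence never to a new vertex. Until it returns to `γ` it cannot reach a new vertex, so it uses
edges open in `η`. Following `γ` from the return on gives a crossing of `η` that beats `γ` at the
same position. -/
lemma isMin_surgery : D.IsMin (D.surgery η γ z w w') γ := by
  have hcr := h.isMin.1
  refine ⟨⟨?_, hcr.nodup, hcr.head, hcr.last⟩, fun l x y s g e hσ => ?_⟩
  · rw [List.isChain_iff_forall_rel_of_append_cons_cons]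
    intro a b l₁ l₂ e
    have hi : [a, b] <:+: γ := ⟨l₁, l₂, by simp [e]⟩
    exact ⟨h.opn_of_infix hi, (rel_of_infix hcr.chain hi).2⟩
  by_contra hlt
  rw [not_le] at hlt
  have hxy : x ≠ y := fun e => by rw [e] at hlt; exact lt_irrefl _ hlt
  -- the preference is the same in `η`, and `x` is not a new vertex unless it is on the path
  have hkey : prio η l x < prio η l y ∧ (x ∉ γ → x ∉ new D η γ z) := by
    rcases List.eq_nil_or_concat l with rfl | ⟨l, u, rfl⟩
    · refine ⟨hlt, fun hx => ?_⟩
      obtain ⟨a, t, e', ha, -⟩ := hσ.head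
      simp at e'
      rw [e'.1]
      rintro (hn | hn)
      · exact h.not_S a ha hn.2
      · exact h.S_not_mem_cluster ha hn
    · rw [List.concat_eq_append] at hlt hσ e ⊢
      have hu : u ∈ γ := by simp [e]
      have hux : D.Opn (D.surgery η γ z w w') u x :=
        (rel_of_infix hσ.chain (a := u) (b := x) ⟨l, s, by simp⟩).1
      have huy : [u, y] <:+: γ := ⟨l, g, by simp [e]⟩
      have hay := (rel_of_infix hcr.chain huy).1.1
      -- In the column `z` the bit of the dart `(u, y)` of `γ` is true and that of `(u, x)` is
      -- false, so `y` ranks below `Fintype.card V` and `x` does not: the competitor cannot win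
      -- here.
      by_cases huz : D.col u = z
      · exfalso
        rw [prio_concat, prio_concat] at hlt
        have h1 : D.surgery η γ z w w' (.inr (u, y)) = true := by
          simp [surgery, huz, hay, huy]
        have h2 : D.surgery η γ z w w' (.inr (u, x)) = false := by
          have : ¬ [u, x] <:+: γ := fun h' => hxy (infix_right_unique hcr.nodup h' huy)
          simp [surgery, huz, hux.1, this]
        have h3 := (Fintype.equivFin V y).2
        simp only [rank, h1, h2] at hlt
        simp at hlt
        omega
      · rw [prio_concat, prio_concat] at hlt ⊢
        have hr : ∀ x, rank (D.surgery η γ z w w') u x = rank η u x := fun x => by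
          simp [rank, surgery, huz]
        rw [hr, hr] at hlt
        exact ⟨hlt, fun _ => h.not_mem_new_of_opn hu huz hux⟩
  obtain ⟨hlt', hxn⟩ := hkey
  have hln : ∀ v ∈ l, v ∉ new D η γ z := fun v hv => h.not_mem_new (by simp [e, hv])
  have hN : ∀ x y, x ∉ γ → x ∉ new D η γ z → D.Step (D.surgery η γ z w w') x y →
      y ∉ new D η γ z := fun x y h1 h2 h3 => h.not_mem_new_of_opn' h1 h2 h3.1
  rcases exists_first_mem (· ∈ γ) (x :: s) with hall | ⟨r, b, s₂, e₂, hb, hr⟩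
  · have hc : (x :: s).IsChain (D.Step (D.surgery η γ z w w')) :=
      (List.isChain_append.1 hσ.chain).2.1
    have hsn := not_mem_of_isChain hN hc hall (by rintro _ _ ⟨⟩; exact hxn (hall _ (by simp)))
    have hσ' := h.crosses_of_not_mem_new hσ fun v hv => by
      rcases List.mem_append.1 hv with hv | hv
      · exact hln v hv
      · exact hsn v hv
    exact absurd hlt' (not_lt.2 (h.isMin.2 l x y s g e hσ'))
  · -- follow the new path until it first returns to `γ`, then follow `γ`
    rw [e₂] at hσ
    have hσnd := hσ.nodup
    have hbl : b ∉ l := fun hbl => (List.nodup_append.1 hσnd).2.2 b hbl b (by simp) rfl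
    have hby : b ∈ y :: g := by
      rw [e] at hb
      exact (List.mem_append.1 hb).resolve_left hbl
    obtain ⟨g₁, g₂, eg⟩ := List.append_of_mem hby
    have hc0 : ((l ++ r) ++ b :: s₂).IsChain (D.Step (D.surgery η γ z w w')) := by
      simpa using hσ.chain
    have hc1 := (List.isChain_split.1 hc0).1
    have hrc : r.IsChain (D.Step (D.surgery η γ z w w')) :=
      (List.isChain_append.1 (List.isChain_append.1 hc1).1).2.1
    have hrn := not_mem_of_isChain hN hrc hr (by
      rintro x' s' rfl
      simp at e₂
      rw [← e₂.1]
      exact hxn (by rw [e₂.1]; exact hr _ (by simp)))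
    have hc2 : ((l ++ r) ++ [b]).IsChain (D.Step η) := by
      refine isChain_imp_of_mem (p := (· ∉ new D η γ z)) hc1 (fun v hv => ?_)
        fun _ _ hv hx hr => ⟨h.opn_of_not_mem_new hr.1 hv hx, hr.2⟩
      simp only [List.mem_append, List.mem_singleton] at hv
      rcases hv with (hv | hv) | rfl
      · exact hln v hv
      · exact hrn v hv
      · exact h.not_mem_new hb
    have hγc := hcr.chain
    have hγn := hcr.nodup
    have e3 : γ = (l ++ g₁) ++ b :: g₂ := by rw [e, eg]; simp
    rw [e3] at hγc hγn
    have hc3 : ((l ++ r) ++ b :: g₂).IsChain (D.Step η) :=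
      List.isChain_split.2 ⟨hc2, (List.isChain_split.1 hγc).2⟩
    have hnd : ((l ++ r) ++ b :: g₂).Nodup := by
      have h1 : (l ++ r).Nodup := by
        have : ((l ++ r) ++ b :: s₂).Nodup := by simpa using hσnd
        exact (List.nodup_append.1 this).1
      refine List.nodup_append.2 ⟨h1, (List.nodup_append.1 hγn).2.1, ?_⟩
      rintro v hv v' hv' rfl
      rcases List.mem_append.1 hv with hv | hv
      · exact (List.nodup_append.1 hγn).2.2 v (by simp [hv]) v hv' rfl
      · refine hr v hv ?_
        rw [e3]; simp only [List.mem_append]; exact .inr hv'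
    -- The spliced path still continues `l` with `x`, even when `x` itself is the return vertex and
    -- `r` is empty.
    obtain ⟨x', ex⟩ : ∃ s', r ++ b :: g₂ = x :: s' := by
      cases r with
      | nil => simp at e₂; exact ⟨g₂, by simp [e₂.1]⟩
      | cons a r => simp at e₂; exact ⟨r ++ b :: g₂, by simp [e₂.1]⟩
    have hnew : D.Crosses η (l ++ x :: x') := by
      rw [← ex, ← List.append_assoc]
      refine ⟨hc3, hnd, ?_, ?_⟩
      · obtain ⟨a, t, ea, ha, ha1⟩ := hσ.head
        cases hlr : l ++ r with
        | nil =>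
          rw [← List.append_assoc, hlr] at ea
          simp at ea
          exact ⟨b, g₂, rfl, ea.1 ▸ ha, ea.1 ▸ ha1⟩
        | cons c lr =>
          rw [← List.append_assoc, hlr] at ea
          simp at ea
          exact ⟨c, lr ++ b :: g₂, rfl, ea.1 ▸ ha, ea.1 ▸ ha1⟩
      · obtain ⟨c, hc, hcT⟩ := hcr.last
        rw [e3] at hc
        refine ⟨c, ?_, hcT⟩
        rw [← hc]; simp [List.getLast?_append, List.getLast?_cons]
    exact absurd hlt' (not_lt.2 (h.isMin.2 l x y x' g e hnew))

end Glueable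

end Setup

/-! ### Candidate columns, and the two modification estimates. -/

namespace Setup

variable {V P : Type*} [Fintype V] (D : Setup V P)

/-- `g` has an open neighbour from which `S'` can be reached without meeting `γ`. -/
def Touches (η : State V) (γ : List V) (g : V) : Prop :=
  ∃ x, D.Opn η g x ∧ ∃ s ∈ D.S', ReachIn (D.Opn η) {v | v ∉ γ} s x

open Classical in
/-- The columns of `γ` containing a vertex that touches the cluster of `S'` off `γ`. -/
noncomputable def contacts (η : State V) (γ : List V) : Finset P :=
  (γ.filter fun g => D.Touches η γ g).toFinset.image D.col

open Classical in
/-- The columns of `γ` next to a vertex that is connected to `S'` in `B₂` off the columns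
of `γ`. -/
noncomputable def candidates (η : State V) (γ : List V) : Finset P :=
  (γ.toFinset.image D.col).filter fun z => ∃ w w', D.G.Adj w' w ∧ D.col w' = z ∧
    ∃ s ∈ D.S', ReachIn (D.Opn η) (D.B₂ ∩ {v | ∀ g ∈ γ, D.col g ≠ D.col v}) s w

open Classical in
/-- The edges meeting the column `z` and the darts starting there. -/
noncomputable def star (z : P) : Finset (Coord V) :=
  Finset.univ.filter fun i => match i with
    | .inl e => e ∈ D.G.edgeSet ∧ ∃ v ∈ e, D.col v = z
    | .inr (v, x) => D.col v = z ∧ D.G.Adj v x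

variable {D}

lemma inl_mem_star {z : P} {e : Sym2 V} :
    (.inl e : Coord V) ∈ D.star z ↔ e ∈ D.G.edgeSet ∧ ∃ v ∈ e, D.col v = z := by
  simp [star]

lemma inr_mem_star {z : P} {v x : V} :
    (.inr (v, x) : Coord V) ∈ D.star z ↔ D.col v = z ∧ D.G.Adj v x := by
  simp [star]

omit [Fintype V] in
lemma mem_contacts {η : State V} {γ : List V} {z : P} :
    z ∈ D.contacts η γ ↔ ∃ g ∈ γ, D.Touches η γ g ∧ D.col g = z := by
  simp [contacts, and_assoc]

lemma mem_candidates {η : State V} {γ : List V} {z : P} :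
    z ∈ D.candidates η γ ↔ (∃ g ∈ γ, D.col g = z) ∧ ∃ w w', D.G.Adj w' w ∧ D.col w' = z ∧
      ∃ s ∈ D.S', ReachIn (D.Opn η) (D.B₂ ∩ {v | ∀ g ∈ γ, D.col g ≠ D.col v}) s w := by
  simp [candidates]

lemma surgery_eq_off (η : State V) (γ : List V) (z : P) (w w' : V) (i : Coord V)
    (hi : i ∉ D.star z) : η i = D.surgery η γ z w w' i := by
  rcases i with e | ⟨v, x⟩
  · rw [inl_mem_star] at hi
    simp only [surgery, if_neg hi]
  · rw [inr_mem_star] at hi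
    simp only [surgery, if_neg hi]

namespace Glueable

variable {η : State V} {γ : List V} {z : P} {w w' : V} (h : D.Glueable η γ z w w')
include h

/-- Exploring from `S'` off `γ` never leaves the new vertices, and a vertex of `γ` outside the
column `z` has no new open neighbour. -/
lemma contacts_subset {g : V} (hg : g ∈ γ) (ht : D.Touches (D.surgery η γ z w w') γ g) :
    D.col g = z := by
  obtain ⟨x, hgx, s, hs, hsx⟩ := ht
  have hx : x ∈ new D η γ z := by
    refine hsx.induct (p := (· ∈ new D η γ z)) (.inr ⟨s, hs, .refl trivial⟩) ?_
    intro a _ b hb hab ha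
    by_contra hbn
    exact h.not_mem_new_of_opn' hb hbn hab.symm ha
  by_contra hgz
  exact h.not_mem_new_of_opn hg hgz hgx hx

/-- The connection from `S'` to `w` avoids the columns of `γ`, so it survives. Cross the bridge to
`w'`, then walk inside the column towards a vertex of `γ`: the first vertex of `γ` met is a contact.
-/
lemma exists_touches (hcol : ∀ v x, D.col v = D.col x →
      ReachIn D.G.Adj {u | D.col u = D.col v} v x) :
    ∃ g ∈ γ, D.Touches (D.surgery η γ z w w') γ g ∧ D.col g = z := by
  obtain ⟨s, hs, hsw⟩ := h.reach
  have hw : ReachIn (D.Opn (D.surgery η γ z w w')) {v | v ∉ γ} s w := by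
    refine hsw.mono (fun a ha b hb hab => ?_) fun a ha ha' => ha a ha' rfl
    exact (opn_iff_of_col_ne (h.col_ne_of_off ha) (h.col_ne_of_off hb)).2 hab
  obtain ⟨g₀, hg₀, hg₀z⟩ := h.exists_mem
  have hr := hcol w' g₀ (by rw [h.col_eq, hg₀z])
  rw [h.col_eq] at hr
  have key : ReachIn (D.Opn (D.surgery η γ z w w')) {v | v ∉ γ} s g₀ ∨
      ∃ g ∈ γ, D.Touches (D.surgery η γ z w w') γ g ∧ D.col g = z := by
    refine hr.induct (p := fun v => ReachIn (D.Opn (D.surgery η γ z w w')) {v | v ∉ γ} s v ∨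
      ∃ g ∈ γ, D.Touches (D.surgery η γ z w w') γ g ∧ D.col g = z) ?_ ?_
    · by_cases hw' : w' ∈ γ
      · exact .inr ⟨w', hw', ⟨w, h.opn_bridge, s, hs, hw⟩, h.col_eq⟩
      · exact .inl (hw.tail h.opn_bridge.symm hw')
    · rintro a ha b hb hab (hp | hp)
      · have ho := opn_column (η := η) (w := w) (w' := w') hab ha hb hp.right_mem
        by_cases hbγ : b ∈ γ
        · exact .inr ⟨b, hbγ, ⟨a, ho.symm, s, hs, hp⟩, hb⟩
        · exact .inl (hp.tail ho hbγ)
      · exact .inr hp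
  exact key.resolve_left fun h' => h'.right_mem hg₀

/-- This makes the surgery invertible up to boundedly many choices: the modified column is
determined by the resulting state. -/
lemma contacts_surgery (hcol : ∀ v x, D.col v = D.col x →
      ReachIn D.G.Adj {u | D.col u = D.col v} v x) :
    D.contacts (D.surgery η γ z w w') (D.minPath (D.surgery η γ z w w')) = {z} := by
  rw [h.isMin_surgery.minPath_eq]
  ext z'
  rw [mem_contacts, Finset.mem_singleton]
  constructor
  · rintro ⟨g, hg, ht, rfl⟩
    exact h.contacts_subset hg ht
  · rintro rfl
    exact h.exists_touches hcol

end Glueable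

variable (D)

/-- The hypotheses on the geometry: regions are unions of columns, columns are connected, and
paths between the targets cannot avoid the columns of a crossing path. -/
structure Planar : Prop where
  satS : ∀ v x, D.col v = D.col x → v ∈ D.S → x ∈ D.S
  satS' : ∀ v x, D.col v = D.col x → v ∈ D.S' → x ∈ D.S'
  column : ∀ v x, D.col v = D.col x → ReachIn D.G.Adj {u | D.col u = D.col v} v x
  cross : ∀ γ : List V, γ.IsChain D.G.Adj → (∀ v ∈ γ, v ∈ D.B₁) →
    (∃ a t, γ = a :: t ∧ a ∈ D.S) → (∃ b, γ.getLast? = some b ∧ b ∈ D.T) →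
    (∀ v ∈ γ, v ∉ D.S') → ∀ s₁ ∈ D.S', ∀ s₂ ∈ D.S', ∀ y₁ ∈ D.Ym, ∀ y₂ ∈ D.Yp,
      ReachIn D.G.Adj (D.B₂ ∩ {v | ∀ g ∈ γ, D.col g ≠ D.col v}) s₁ y₁ →
      ReachIn D.G.Adj (D.B₂ ∩ {v | ∀ g ∈ γ, D.col g ≠ D.col v}) s₂ y₂ → False

/-- The hypothesis of the gluing lemma. -/
def Hyp (η : State V) : Prop :=
  D.Joins η D.B₁ D.S D.T ∧ D.Joins η D.B₂ D.S' D.Ym ∧ D.Joins η D.B₂ D.S' D.Yp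

/-- The conclusion of the gluing lemma. -/
def Concl (η : State V) : Prop := D.Joins η Set.univ D.S D.S'

open Classical in
/-- Close the edges meeting the columns in `U` other than those of `γ`. -/
noncomputable def cutting (η : State V) (γ : List V) (U : Finset P) : State V
  | .inl e => η (.inl e) && decide ((∃ z ∈ U, (.inl e : Coord V) ∈ D.star z) →
      ∃ a b, [a, b] <:+: γ ∧ e = s(a, b))
  | .inr d => η (.inr d)

variable {D}

lemma cutting_inl_iff {η : State V} {γ : List V} {U : Finset P} {e : Sym2 V} :
    D.cutting η γ U (.inl e) = true ↔ η (.inl e) = true ∧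
      ((∃ z ∈ U, (.inl e : Coord V) ∈ D.star z) → ∃ a b, [a, b] <:+: γ ∧ e = s(a, b)) := by
  rw [cutting, Bool.and_eq_true]
  exact and_congr_right fun _ => @decide_eq_true_iff _ (_)

lemma cutting_eq_off [DecidableEq (Coord V)] (η : State V) (γ : List V) (U : Finset P)
    (i : Coord V) (hi : i ∉ U.biUnion D.star) : η i = D.cutting η γ U i := by
  rcases i with e | d
  · rw [Bool.eq_iff_iff, cutting_inl_iff]
    refine ⟨fun h => ⟨h, fun ⟨z, hz, he⟩ => (hi ?_).elim⟩, fun h => h.1⟩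
    exact Finset.mem_biUnion.2 ⟨z, hz, he⟩
  · rfl

lemma isMin_cutting {η : State V} {γ : List V} (h : D.IsMin η γ) (U : Finset P) :
    D.IsMin (D.cutting η γ U) γ := by
  refine h.of_le (fun e he => (cutting_inl_iff.1 he).1) (fun _ => rfl) fun a b hab => ?_
  exact cutting_inl_iff.2 ⟨(rel_of_infix h.1.chain hab).1.2, fun _ => ⟨a, b, hab, rfl⟩⟩

lemma opn_cutting_iff {η : State V} {γ : List V} {U : Finset P}
    (hU : ∀ z ∈ U, ∃ g ∈ γ, D.col g = z) {v x : V} (hv : ∀ g ∈ γ, D.col g ≠ D.col v)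
    (hx : ∀ g ∈ γ, D.col g ≠ D.col x) : D.Opn (D.cutting η γ U) v x ↔ D.Opn η v x := by
  unfold Opn
  rw [cutting_inl_iff]
  refine and_congr_right fun _ => ⟨fun h => h.1, fun h => ⟨h, ?_⟩⟩
  rintro ⟨z, hz, hs⟩
  exfalso
  obtain ⟨g, hg, rfl⟩ := hU z hz
  obtain ⟨u, hu, e⟩ := (inl_mem_star.1 hs).2
  rcases Sym2.mem_iff.1 hu with rfl | rfl
  · exact hv g hg e.symm
  · exact hx g hg e.symm

/-- Candidates depend only on connections off the columns of `γ`, where cutting closes nothing. The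
set of cut columns can therefore be recovered from the result. -/
lemma candidates_cutting (η : State V) (γ : List V) :
    D.candidates (D.cutting η γ (D.candidates η γ)) γ = D.candidates η γ := by
  have hU : ∀ z ∈ D.candidates η γ, ∃ g ∈ γ, D.col g = z := fun z hz => (mem_candidates.1 hz).1
  generalize hUd : D.candidates η γ = U at hU
  rw [← hUd]
  ext z
  rw [mem_candidates, mem_candidates]
  rw [hUd]
  refine and_congr_right fun _ => exists_congr fun w => exists_congr fun w' =>
    and_congr_right fun _ => and_congr_right fun _ => exists_congr fun s =>
    and_congr_right fun _ => ⟨fun h => ?_, fun h => ?_⟩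
  · exact h.mono (fun a ha b hb hab => (opn_cutting_iff hU ha.2 hb.2).1 hab) subset_rfl
  · exact h.mono (fun a ha b hb hab => (opn_cutting_iff hU ha.2 hb.2).2 hab) subset_rfl

/-- After cutting, a path in `B₂` from `S'` can no longer enter a column of `γ`, so having paths to
both `Ym` and `Yp` would contradict planarity. -/
lemma not_hyp_cutting (hD : D.Planar) {η : State V} {γ : List V} (h : D.IsMin η γ)
    (hE : ¬ D.Concl η) : ¬ D.Hyp (D.cutting η γ (D.candidates η γ)) := by
  rintro ⟨-, ⟨s₁, hs₁, y₁, hy₁, h₁⟩, s₂, hs₂, y₂, hy₂, h₂⟩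
  have hγS : ∀ v ∈ γ, v ∉ D.S' := fun v hv hvS => by
    obtain ⟨a, ha, hav⟩ := h.1.reach hv
    exact hE ⟨a, ha, v, hvS, hav⟩
  have hoff : ∀ s ∈ D.S', ∀ g ∈ γ, D.col g ≠ D.col s := fun s hs g hg e =>
    hγS g hg (hD.satS' s g e.symm hs)
  have key : ∀ s ∈ D.S', ∀ y, ReachIn (D.Opn (D.cutting η γ (D.candidates η γ))) D.B₂ s y →
      ReachIn (D.Opn η) (D.B₂ ∩ {v | ∀ g ∈ γ, D.col g ≠ D.col v}) s y := by
    intro s hs y hy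
    refine hy.induct (p := ReachIn (D.Opn η) (D.B₂ ∩ {v | ∀ g ∈ γ, D.col g ≠ D.col v}) s)
      (.refl ⟨hy.left_mem, hoff s hs⟩) ?_
    intro a _ b hb hab ha
    refine ha.tail ⟨hab.1, (cutting_inl_iff.1 hab.2).1⟩ ⟨hb, ?_⟩
    intro g hg e
    -- The first entrance into a column of `γ` would exhibit that column as a candidate, and the
    -- edge used, not being on `γ`, has been closed.
    have hz : D.col b ∈ D.candidates η γ :=
      mem_candidates.2 ⟨⟨g, hg, e⟩, a, b, hab.1.symm, rfl, s, hs, ha⟩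
    obtain ⟨u, v, huv, e'⟩ := (cutting_inl_iff.1 hab.2).2
      ⟨_, hz, inl_mem_star.2 ⟨hab.1, b, by simp, rfl⟩⟩
    have haγ : a ∈ γ := by
      have : a ∈ s(u, v) := by rw [← e']; simp
      rcases Sym2.mem_iff.1 this with rfl | rfl
      · exact huv.subset (by simp)
      · exact huv.subset (by simp)
    exact ha.right_mem.2 a haγ rfl
  refine hD.cross γ (h.1.chain.imp fun _ _ h => h.1.1) (fun v hv => h.1.mem_B₁ hv) ?_ h.1.last hγS
    s₁ hs₁ s₂ hs₂ y₁ hy₁ y₂ hy₂ ?_ ?_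
  · obtain ⟨a, t, e, ha, -⟩ := h.1.head
    exact ⟨a, t, e, ha⟩
  · exact (key s₁ hs₁ y₁ h₁).mono (fun _ _ _ _ h => h.1) subset_rfl
  · exact (key s₂ hs₂ y₂ h₂).mono (fun _ _ _ _ h => h.1) subset_rfl

section probability

variable (p : unitInterval) {m : ℝ} (hm : 0 < m) (hm1 : m ≤ 1) (hp : ∀ b, m ≤ mass p b)
  (M : ℕ) (hM : ∀ z, (D.star z).card ≤ M) (t : ℕ)
include hm hm1 hp hM

/-- Each state has the single image given by `cutting`, labelled by its candidate set; at most `t`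
columns of at most `M` coordinates change. -/
lemma bern_few_candidates (hD : D.Planar) :
    (bern (Coord V) p).real {η | D.Hyp η ∧ ¬ D.Concl η ∧ (D.candidates η (D.minPath η)).card ≤ t} ≤
      (2 * m⁻¹) ^ (t * M) * (bern (Coord V) p).real {η | ¬ D.Hyp η} := by
  classical
  have := mul_bern_real_le_of_modification p hm hm1 hp (t * M) 1
    (fun U : Finset P => U.biUnion D.star)
    {η | D.Hyp η ∧ ¬ D.Concl η ∧ (D.candidates η (D.minPath η)).card ≤ t}
    {η | ¬ D.Hyp η ∧ (D.candidates η (D.minPath η)).card ≤ t}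
    (fun η => D.candidates η (D.minPath η)) ?_ ?_
  · rw [Nat.cast_one, one_mul] at this
    refine this.trans (mul_le_mul_of_nonneg_left ?_ (by positivity))
    exact measureReal_mono fun η hη => hη.1
  · intro η hη
    exact (Finset.card_biUnion_le_card_mul _ _ _ fun z _ => hM z).trans
      (Nat.mul_le_mul_right _ hη.2)
  · rintro η ⟨hH, hE, hc⟩
    obtain ⟨γ, hγ⟩ := D.exists_isMin hH.1
    rw [hγ.minPath_eq] at hc
    refine ⟨{D.candidates η γ}, by simp, ?_⟩
    intro z hz
    rw [Finset.mem_singleton] at hz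
    subst hz
    have e : D.candidates (D.cutting η γ (D.candidates η γ))
        (D.minPath (D.cutting η γ (D.candidates η γ))) = D.candidates η γ := by
      rw [(isMin_cutting hγ _).minPath_eq, candidates_cutting]
    refine ⟨D.cutting η γ (D.candidates η γ), ⟨not_hyp_cutting hD hγ hE, ?_⟩, e, ?_⟩
    · rw [e]; exact hc
    · exact fun i hi => cutting_eq_off η γ _ i hi

/-- The surgery at different columns gives images with different contact sets, so each state has at
least `t` images, each changing at most `M` coordinates. -/
lemma bern_many_candidates (hD : D.Planar) :
    t * (bern (Coord V) p).real
      {η | D.Hyp η ∧ ¬ D.Concl η ∧ t < (D.candidates η (D.minPath η)).card} ≤ (2 * m⁻¹) ^ M := by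
  classical
  have := mul_bern_real_le_of_modification p hm hm1 hp M t
    (fun U : Finset P => U.biUnion D.star)
    {η | D.Hyp η ∧ ¬ D.Concl η ∧ t < (D.candidates η (D.minPath η)).card}
    {η | (D.contacts η (D.minPath η)).card ≤ 1}
    (fun η => D.contacts η (D.minPath η)) ?_ ?_
  · refine this.trans ?_
    have h1 : 0 ≤ (2 * m⁻¹) ^ M := by positivity
    nlinarith [measureReal_le_one (μ := bern (Coord V) p)
      (s := {η | (D.contacts η (D.minPath η)).card ≤ 1})]
  · intro η hη
    exact (Finset.card_biUnion_le_card_mul _ _ _ fun z _ => hM z).trans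
      (by simpa using Nat.mul_le_mul_right M hη)
  · rintro η ⟨hH, hE, hc⟩
    obtain ⟨γ, hγ⟩ := D.exists_isMin hH.1
    rw [hγ.minPath_eq] at hc
    obtain ⟨a, l, el, haS, -⟩ := hγ.1.head
    -- Surgery is not allowed in a column of `S`. As `γ` meets `S` only at its start, one column is
    -- lost, and the strict inequality leaves `t` of them.
    refine ⟨((D.candidates η γ).erase (D.col a)).image fun z => {z}, ?_, ?_⟩
    · rw [Finset.card_image_of_injective _ Finset.singleton_injective]
      have := Finset.pred_card_le_card_erase (s := D.candidates η γ) (a := D.col a)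
      omega
    · intro Z hZ
      obtain ⟨z, hz, rfl⟩ := Finset.mem_image.1 hZ
      obtain ⟨hza, hz⟩ := Finset.mem_erase.1 hz
      obtain ⟨⟨g, hg, hgz⟩, w, w', hadj, hw', s, hs, hsw⟩ := mem_candidates.1 hz
      have hglue : D.Glueable η γ z w w' := by
        refine ⟨hγ, hE, ⟨g, hg, hgz⟩, fun v hv hvz => ?_, hadj, hw', s, hs,
          hsw.mono (fun _ _ _ _ h => h) Set.inter_subset_right⟩
        have hgS : g ∈ D.S := hD.satS v g (hvz.trans hgz.symm) hv
        rw [el] at hg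
        rcases List.mem_cons.1 hg with rfl | hgl
        · exact hza hgz.symm
        · obtain ⟨l₁, l₂, e⟩ := List.append_of_mem hgl
          exact hγ.1.not_mem_S_of_append (l := a :: l₁) (by rw [el, e]; rfl) (by simp) hgS
      have e := hglue.contacts_surgery hD.column
      refine ⟨D.surgery η γ z w w', ?_, e, fun i hi => ?_⟩
      · change (D.contacts _ _).card ≤ 1
        rw [e]; simp
      · exact surgery_eq_off η γ z w w' i (by simpa using hi)

theorem bern_gluing (hD : D.Planar) (ht : 0 < t) :
    (bern (Coord V) p).real {η | ¬ D.Concl η} ≤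
      (1 + (2 * m⁻¹) ^ (t * M)) * (bern (Coord V) p).real {η | ¬ D.Hyp η} +
        (2 * m⁻¹) ^ M / t := by
  have h1 := bern_few_candidates p hm hm1 hp M hM t hD
  have h2 := bern_many_candidates p hm hm1 hp M hM t hD
  rw [mul_comm, ← le_div_iff₀ (by exact_mod_cast ht)] at h2
  have h3 : {η | ¬ D.Concl η} ⊆ {η | ¬ D.Hyp η} ∪
      ({η | D.Hyp η ∧ ¬ D.Concl η ∧ (D.candidates η (D.minPath η)).card ≤ t} ∪
      {η | D.Hyp η ∧ ¬ D.Concl η ∧ t < (D.candidates η (D.minPath η)).card}) := by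
    intro η hη
    by_cases hH : D.Hyp η
    · rcases le_or_gt (D.candidates η (D.minPath η)).card t with h | h
      · exact .inr (.inl ⟨hH, hη, h⟩)
      · exact .inr (.inr ⟨hH, hη, h⟩)
    · exact .inl hH
  have h4 := (measureReal_mono (μ := bern (Coord V) p) h3).trans
    ((measureReal_union_le _ _).trans (add_le_add_right (measureReal_union_le _ _) _))
  linarith

end probability

end Setup

/-! ### Planar topology: a crossing number modulo 2. -/

/-- Points of `ℤ²` at `ℓ¹`-distance at most one. -/
def PlanarStep (v w : ℤ × ℤ) : Prop := |v.1 - w.1| + |v.2 - w.2| ≤ 1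

lemma planarStep_cases {v w : ℤ × ℤ} (h : PlanarStep v w) :
    v = w ∨ (w.1 = v.1 + 1 ∧ w.2 = v.2) ∨ (v.1 = w.1 + 1 ∧ v.2 = w.2) ∨
      (w.2 = v.2 + 1 ∧ w.1 = v.1) ∨ (v.2 = w.2 + 1 ∧ v.1 = w.1) := by
  unfold PlanarStep at h
  rw [Prod.ext_iff]
  rcases abs_cases (v.1 - w.1) with ⟨h1, _⟩ | ⟨h1, _⟩ <;>
  rcases abs_cases (v.2 - w.2) with ⟨h2, _⟩ | ⟨h2, _⟩ <;> omega

/-- The crossings by the step `vw` of the horizontal half-line to the left of `h`, mod 2. -/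
def crossing (h v w : ℤ × ℤ) : ZMod 2 :=
  if v.1 < h.1 then (if v.2 ≤ h.2 then 1 else 0) + (if w.2 ≤ h.2 then 1 else 0) else 0

/-- Only a vertical step on the line through `h` could be counted additionally, and one of its ends
would be `h`. -/
lemma crossing_right {v w h h' : ℤ × ℤ} (hc : PlanarStep v w) (e1 : h'.1 = h.1 + 1)
    (e2 : h'.2 = h.2) (hv : v ≠ h) (hw : w ≠ h) : crossing h' v w = crossing h v w := by
  unfold crossing
  rw [e1, e2]
  rw [Ne, Prod.ext_iff] at hv hw
  rcases planarStep_cases hc with rfl | hc | hc | hc | hc <;> split_ifs <;>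
    first | rfl | omega

/-- Raising the half-line changes the count by a term for each end of the step. Along a path these
terms telescope modulo 2 and only the endpoints of the path remain. -/
lemma crossing_up {v w h h' : ℤ × ℤ} (hc : PlanarStep v w) (e1 : h'.2 = h.2 + 1)
    (e2 : h'.1 = h.1) (hv : v ≠ h') (hw : w ≠ h') : crossing h' v w = crossing h v w +
      ((if v.1 < h.1 ∧ v.2 = h.2 + 1 then 1 else 0) +
        (if w.1 < h.1 ∧ w.2 = h.2 + 1 then 1 else 0)) := by
  unfold crossing
  rw [Ne, Prod.ext_iff] at hv hw
  rw [e1, e2] at *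
  rcases planarStep_cases hc with rfl | hc | hc | hc | hc <;> split_ifs <;>
    first | rfl | omega

lemma crossing_eq {v w h : ℤ × ℤ} (hc : PlanarStep v w) (hw1 : w.1 ≤ h.1)
    (hv : v ≠ h) (hw : w ≠ h) :
    crossing h v w = (if v.2 ≤ h.2 then 1 else 0) + (if w.2 ≤ h.2 then 1 else 0) := by
  unfold crossing
  rw [Ne, Prod.ext_iff] at hv hw
  rcases planarStep_cases hc with rfl | hc | hc | hc | hc <;> split_ifs <;>
    first | rfl | omega

lemma zmod_two_add (i x y : ZMod 2) : i + x + (x + y) = i + y := by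
  revert i x y; decide

lemma zmod_two_add' (j i x c y : ZMod 2) : j + (i + x) + (c + (x + y)) = j + c + (i + y) := by
  revert i x y j c; decide

/-- `N h` sums `crossing h` over the steps of the path. It is locally constant off the path, up to
contributions of the endpoints `a` and `b`. -/
lemma exists_crossing_number {A H : Set (ℤ × ℤ)} {xl xr : ℤ} {a b : ℤ × ℤ}
    (hAH : ∀ v ∈ A, v ∉ H) (hA : ∀ v ∈ A, xl ≤ v.1 ∧ v.1 ≤ xr) (hab : ReachIn PlanarStep A a b) :
    ∃ N : ℤ × ℤ → ZMod 2,
      (∀ h h' : ℤ × ℤ, h ∈ H → h' ∈ H → h'.1 = h.1 + 1 → h'.2 = h.2 → N h' = N h) ∧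
      (∀ h h' : ℤ × ℤ, h ∈ H → h' ∈ H → h'.2 = h.2 + 1 → h'.1 = h.1 →
        N h' = N h + ((if a.1 < h.1 ∧ a.2 = h.2 + 1 then 1 else 0) +
          (if b.1 < h.1 ∧ b.2 = h.2 + 1 then 1 else 0))) ∧
      (∀ h ∈ H, h.1 ≤ xl → N h = 0) ∧
      (∀ h ∈ H, h.1 = xr →
        N h = (if a.2 ≤ h.2 then 1 else 0) + (if b.2 ≤ h.2 then 1 else 0)) := by
  have h11 : (1 : ZMod 2) + 1 = 0 := by decide
  refine hab.induct (p := fun b => ∃ N : ℤ × ℤ → ZMod 2,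
      (∀ h h' : ℤ × ℤ, h ∈ H → h' ∈ H → h'.1 = h.1 + 1 → h'.2 = h.2 → N h' = N h) ∧
      (∀ h h' : ℤ × ℤ, h ∈ H → h' ∈ H → h'.2 = h.2 + 1 → h'.1 = h.1 →
        N h' = N h + ((if a.1 < h.1 ∧ a.2 = h.2 + 1 then 1 else 0) +
          (if b.1 < h.1 ∧ b.2 = h.2 + 1 then 1 else 0))) ∧
      (∀ h ∈ H, h.1 ≤ xl → N h = 0) ∧
      (∀ h ∈ H, h.1 = xr →
        N h = (if a.2 ≤ h.2 then 1 else 0) + (if b.2 ≤ h.2 then 1 else 0))) ?_ ?_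
  · refine ⟨fun _ => 0, fun _ _ _ _ _ _ => rfl, fun h _ _ _ _ _ => ?_, fun _ _ _ => rfl,
      fun h _ _ => ?_⟩
    · split_ifs <;> simp [h11]
    · split_ifs <;> simp [h11]
  · rintro v hv w hw hvw ⟨N, h1, h2, h3, h4⟩
    have hvH := hAH v hv
    have hwH := hAH w hw
    have hvne : ∀ h ∈ H, v ≠ h := fun h hh e => hvH (e ▸ hh)
    have hwne : ∀ h ∈ H, w ≠ h := fun h hh e => hwH (e ▸ hh)
    obtain ⟨hv1, hv2⟩ := hA v hv
    obtain ⟨hw1, hw2⟩ := hA w hw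
    refine ⟨fun h => N h + crossing h v w, fun h h' hh hh' e1 e2 => ?_,
      fun h h' hh hh' e1 e2 => ?_, fun h hh e => ?_, fun h hh e => ?_⟩
    · beta_reduce
      rw [h1 h h' hh hh' e1 e2, crossing_right hvw e1 e2 (hvne h hh) (hwne h hh)]
    · beta_reduce
      rw [h2 h h' hh hh' e1 e2, crossing_up hvw e1 e2 (hvne h' hh') (hwne h' hh'),
        zmod_two_add']
    · beta_reduce
      rw [h3 h hh e, crossing, if_neg (by omega), add_zero]
    · beta_reduce
      rw [h4 h hh e, crossing_eq hvw (by omega) (hvne h hh) (hwne h hh), zmod_two_add]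

/-- Two planar paths whose endpoints on the line `x = xr` interlace must meet, if one stays in the
strip `xl ≤ x ≤ xr` and the other in `x ≤ xr`, starting with `x ≤ xl`. -/
theorem planar_paths_meet {A H : Set (ℤ × ℤ)} {xl xr : ℤ} {a b c d : ℤ × ℤ}
    (hAH : ∀ v ∈ A, v ∉ H) (hA : ∀ v ∈ A, xl ≤ v.1 ∧ v.1 ≤ xr) (hH : ∀ v ∈ H, v.1 ≤ xr)
    (hab : ReachIn PlanarStep A a b) (hcd : ReachIn PlanarStep H c d)
    (ha : a.1 = xr) (hb : b.1 = xr) (hd : d.1 = xr) (hc : c.1 ≤ xl)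
    (had : a.2 ≤ d.2) (hdb : d.2 ≤ b.2) : False := by
  obtain ⟨N, h1, h2, h3, h4⟩ := exists_crossing_number hAH hA hab
  have hconst : N d = 0 := by
    refine hcd.induct (p := fun v => N v = 0) (h3 c hcd.left_mem hc) ?_
    intro v hv w hw hvw hN
    have hv' := hH v hv
    have hw' := hH w hw
    rcases planarStep_cases hvw with rfl | ⟨e1, e2⟩ | ⟨e1, e2⟩ | ⟨e1, e2⟩ | ⟨e1, e2⟩
    · exact hN
    · rw [h1 v w hv hw e1 e2, hN]
    · rw [← h1 w v hw hv e1 e2, hN]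
    · rw [h2 v w hv hw e1 e2, hN, if_neg (by omega), if_neg (by omega)]; simp
    · have := h2 w v hw hv e1 e2
      rw [hN, if_neg (by omega), if_neg (by omega)] at this
      simpa using this.symm
  -- `b` and `d` lie on disjoint paths, so the second inequality is strict and `N d` would have to
  -- be `1`.
  have hbd : ¬ b.2 ≤ d.2 := fun h =>
    hAH b hab.right_mem (by
      have : b = d := Prod.ext (hb.trans hd.symm) (le_antisymm h hdb)
      rw [this]; exact hcd.right_mem)
  have := h4 d hcd.right_mem hd
  rw [hconst, if_pos had, if_neg hbd] at this
  exact absurd this (by decide)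

/-! ### Peierls bound for long chains of nearby edges. -/

section chains

variable {J : Type*} [DecidableEq J] (nb : J → Finset J)

/-- The chains of `L` steps along `nb` that start at a given index. -/
def chainsFrom : ℕ → J → Finset (List J)
  | 0, i => {[i]}
  | L + 1, i => (nb i).biUnion fun j => (chainsFrom L j).image (i :: ·)

lemma card_chainsFrom_le {Δ : ℕ} (h : ∀ i, (nb i).card ≤ Δ) (L : ℕ) (i : J) :
    (chainsFrom nb L i).card ≤ Δ ^ L := by
  induction L generalizing i with
  | zero => simp [chainsFrom]
  | succ L ih =>
    rw [chainsFrom, pow_succ']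
    refine (Finset.card_biUnion_le_card_mul _ _ _ fun j _ => ?_).trans
      (Nat.mul_le_mul_right _ (h i))
    exact Finset.card_image_le.trans (ih j)

lemma mem_chainsFrom {i : J} {l : List J} (h : (i :: l).IsChain fun a b => b ∈ nb a) :
    i :: l ∈ chainsFrom nb l.length i := by
  induction l generalizing i with
  | nil => simp [chainsFrom]
  | cons j l ih =>
    rw [List.isChain_cons_cons] at h
    rw [List.length_cons, chainsFrom]
    exact Finset.mem_biUnion.2 ⟨j, h.1, Finset.mem_image_of_mem _ (ih h.2)⟩

/-- Union bound over the simple chains with a given number of steps. -/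
theorem bern_real_exists_chain_le (p : unitInterval) (b : Bool) {Δ : ℕ}
    (h : ∀ i, (nb i).card ≤ Δ) (W : Finset J) (L : ℕ) :
    (bern J p).real {ω | ∃ i ∈ W, ∃ l : List J, l.length = L ∧
      ((i :: l).IsChain fun a b => b ∈ nb a) ∧ (i :: l).Nodup ∧ ∀ j ∈ i :: l, ω j = b} ≤
      W.card * Δ ^ L * mass p b ^ (L + 1) := by
  set C := W.biUnion fun i => (chainsFrom nb L i).filter fun l => l.Nodup ∧ l.length = L + 1
  have hC : C.card ≤ W.card * Δ ^ L := by
    refine Finset.card_biUnion_le_card_mul _ _ _ fun i _ => ?_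
    exact (Finset.card_filter_le _ _).trans (card_chainsFrom_le nb h L i)
  calc _ ≤ (bern J p).real (⋃ l ∈ C, {ω | ∀ j ∈ l.toFinset, ω j = b}) := by
        refine measureReal_mono ?_ (measure_ne_top _ _)
        rintro ω ⟨i, hi, l, rfl, hc, hnd, hω⟩
        simp only [Set.mem_iUnion]
        refine ⟨i :: l, ?_, fun j hj => hω j (List.mem_toFinset.1 hj)⟩
        exact Finset.mem_biUnion.2 ⟨i, hi, Finset.mem_filter.2 ⟨mem_chainsFrom nb hc, hnd, by simp⟩⟩
    _ ≤ ∑ l ∈ C, (bern J p).real {ω | ∀ j ∈ l.toFinset, ω j = b} :=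
        measureReal_biUnion_finset_le _ _
    _ = ∑ l ∈ C, mass p b ^ (L + 1) := by
        refine Finset.sum_congr rfl fun l hl => ?_
        obtain ⟨i, _, hl⟩ := Finset.mem_biUnion.1 hl
        obtain ⟨_, hnd, hlen⟩ := Finset.mem_filter.1 hl
        rw [bern_real_forall_eq, List.toFinset_card_of_nodup hnd, hlen]
    _ = C.card * mass p b ^ (L + 1) := by simp
    _ ≤ _ := by
        refine mul_le_mul_of_nonneg_right ?_ (pow_nonneg (mass_nonneg p b) _)
        exact_mod_cast hC

end chains

lemma abs_sub_le_of_isChain {J : Type*} {r : J → J → Prop} (pos : J → ℤ)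
    (hr : ∀ i j, r i j → |pos i - pos j| ≤ 2) : ∀ (a : J) (l : List J) (c : J),
    (a :: l).IsChain r → (a :: l).getLast? = some c → |pos a - pos c| ≤ 2 * l.length
  | a, [], c, _, h => by simp at h; simp [h]
  | a, d :: l, c, hc, h => by
    rw [List.isChain_cons_cons] at hc
    have h1 := hr _ _ hc.1
    have h2 := abs_sub_le_of_isChain pos hr d l c hc.2 (by simpa [List.getLast?_cons] using h)
    have h3 := abs_sub_le (pos a) (pos d) (pos c)
    push_cast [List.length_cons]
    linarith

section slab

variable {k : ℕ}

/-- Edges of the slab whose planar projections are close. -/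
def Near (e f : (slab k).edgeSet) : Prop :=
  ∀ v ∈ e.1, ∀ w ∈ f.1, |v.1.1 - w.1.1| ≤ 2 ∧ |v.1.2 - w.1.2| ≤ 2

/-- The edges with both endpoints in a finite set. -/
noncomputable def edgesIn (A : Finset (Vertex k)) : Finset (slab k).edgeSet := by
  classical
  exact ((A ×ˢ A).image fun q => s(q.1, q.2)).subtype (· ∈ (slab k).edgeSet)

lemma mem_edgesIn {A : Finset (Vertex k)} {e : (slab k).edgeSet} :
    e ∈ edgesIn A ↔ ∀ v ∈ e.1, v ∈ A := by
  classical
  obtain ⟨e, he⟩ := e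
  induction e using Sym2.ind with | _ x y
  simp only [edgesIn, Finset.mem_subtype, Finset.mem_image, Finset.mem_product,
    Sym2.mem_iff, forall_eq_or_imp, forall_eq]
  constructor
  · rintro ⟨⟨a, b⟩, ⟨ha, hb⟩, e⟩
    rcases Sym2.eq_iff.1 e with ⟨rfl, rfl⟩ | ⟨rfl, rfl⟩
    · exact ⟨ha, hb⟩
    · exact ⟨hb, ha⟩
  · rintro ⟨hx, hy⟩
    exact ⟨(x, y), ⟨hx, hy⟩, rfl⟩

lemma card_edgesIn_le (A : Finset (Vertex k)) : (edgesIn A).card ≤ A.card ^ 2 := by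
  classical
  unfold edgesIn
  rw [Finset.card_subtype]
  refine (Finset.card_filter_le _ _).trans (Finset.card_image_le.trans ?_)
  rw [Finset.card_product, sq]

/-- The part of the slab over a rectangle. -/
noncomputable def window (k : ℕ) (a b c d : ℤ) : Finset (Vertex k) :=
  (Finset.Icc a b ×ˢ Finset.Icc c d) ×ˢ Finset.univ

lemma mem_window {a b c d : ℤ} {v : Vertex k} :
    v ∈ window k a b c d ↔ (a ≤ v.1.1 ∧ v.1.1 ≤ b) ∧ c ≤ v.1.2 ∧ v.1.2 ≤ d := by
  simp [window]

lemma card_window (a b c d : ℤ) :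
    (window k a b c d).card = (b + 1 - a).toNat * (d + 1 - c).toNat * (k + 1) := by
  simp [window]

/-- An endpoint of an edge. -/
noncomputable def endpoint (e : (slab k).edgeSet) : Vertex k := (Quot.out e.1).1

lemma endpoint_mem (e : (slab k).edgeSet) : endpoint e ∈ e.1 := Sym2.out_fst_mem e.1

/-- The edges near a given edge. -/
noncomputable def nearEdges (e : (slab k).edgeSet) : Finset (slab k).edgeSet :=
  edgesIn (window k ((endpoint e).1.1 - 2) ((endpoint e).1.1 + 2)
    ((endpoint e).1.2 - 2) ((endpoint e).1.2 + 2))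

lemma mem_nearEdges {e f : (slab k).edgeSet} (h : Near e f) : f ∈ nearEdges e := by
  rw [nearEdges, mem_edgesIn]
  intro v hv
  have := h _ (endpoint_mem e) v hv
  rw [abs_le, abs_le] at this
  rw [mem_window]
  omega

lemma card_nearEdges_le (e : (slab k).edgeSet) : (nearEdges e).card ≤ (25 * (k + 1)) ^ 2 := by
  refine (card_edgesIn_le _).trans (Nat.pow_le_pow_left ?_ 2)
  rw [card_window]
  refine Nat.mul_le_mul_right _ (le_of_eq ?_)
  have h1 : ((endpoint e).1.1 + 2 + 1 - ((endpoint e).1.1 - 2)).toNat = 5 := by omega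
  have h2 : ((endpoint e).1.2 + 2 + 1 - ((endpoint e).1.2 - 2)).toNat = 5 := by omega
  rw [h1, h2]

lemma abs_sub_le_one_of_mem {e : (slab k).edgeSet} {v w : Vertex k} (hv : v ∈ e.1)
    (hw : w ∈ e.1) : |v.1.1 - w.1.1| ≤ 1 ∧ |v.1.2 - w.1.2| ≤ 1 := by
  obtain ⟨e, he⟩ := e
  induction e using Sym2.ind with | _ x y
  have hxy : |x.1.1 - y.1.1| + |x.1.2 - y.1.2| + |((x.2 : ℕ) : ℤ) - ((y.2 : ℕ) : ℤ)| = 1 := he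
  have h1 := abs_nonneg (x.1.1 - y.1.1)
  have h2 := abs_nonneg (x.1.2 - y.1.2)
  have h3 := abs_nonneg (((x.2 : ℕ) : ℤ) - ((y.2 : ℕ) : ℤ))
  have hxy' : |x.1.1 - y.1.1| ≤ 1 ∧ |x.1.2 - y.1.2| ≤ 1 := by omega
  rcases Sym2.mem_iff.1 hv with rfl | rfl <;> rcases Sym2.mem_iff.1 hw with rfl | rfl
  · simp
  · exact hxy'
  · rwa [abs_sub_comm, abs_sub_comm v.1.2]
  · simp

/-- The edges near the right side of the box `Bₙ'`. -/
noncomputable def startEdges (k n : ℕ) : Finset (slab k).edgeSet :=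
  edgesIn (window k (3 * n - 1) (3 * n + 1) (-(3 * n) - 1) (4 * n + 1))

/-- Some chain of near edges in state `b` leads from the line `x = 3n` to a place with
`x ≤ x₀`. -/
def Linked (b : Bool) (n : ℕ) (x₀ : ℤ) (ω : Config k) : Prop :=
  ∃ e₀ ∈ startEdges k n, ∃ e₁, (∃ v ∈ e₀.1, v.1.1 = 3 * n) ∧ (∃ v ∈ e₁.1, v.1.1 ≤ x₀) ∧
    ReachIn Near {e | ω e = b} e₀ e₁

/-- The constant in the bound on the probability of long chains. -/
def chainConst (k : ℕ) : ℕ := 90000 * (k + 1) ^ 2 * (25 * (k + 1)) ^ 2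

/-- The number of starting edges grows at most quadratically in `n` and is absorbed by `4 ^ (L +
1)`, leaving a power of `4 * Δ * q`. When this base is below `1`, keeping one factor gives a bound
uniform in `n`; otherwise the claim is trivial. -/
theorem bern_real_linked_le (p : unitInterval) (b : Bool) {n : ℕ} (hn : 1 ≤ n) {x₀ : ℤ}
    (hx : 3 * x₀ ≤ 7 * n) :
    (bern (slab k).edgeSet p).real {ω | Linked b n x₀ ω} ≤ chainConst k * mass p b := by
  classical
  set q := mass p b with hq
  have hq0 : 0 ≤ q := mass_nonneg p b
  set Δ := (25 * (k + 1)) ^ 2 with hΔ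
  rcases le_or_gt 1 (4 * Δ * q) with hbig | hsmall
  · refine measureReal_le_one.trans (hbig.trans (mul_le_mul_of_nonneg_right ?_ hq0))
    unfold chainConst
    rw [← hΔ]
    have h1 : 4 ≤ 90000 * (k + 1) ^ 2 := by
      have : 1 ≤ (k + 1) ^ 2 := Nat.one_le_pow _ _ (by omega)
      omega
    have : 4 * Δ ≤ 90000 * (k + 1) ^ 2 * Δ := Nat.mul_le_mul_right _ h1
    exact_mod_cast this
  -- The chain covers a horizontal distance of at least `2n/3`. The choice of `endpoint` loses at
  -- most `1` at each end and a step advances by at most `2`, so there are at least `n/3 - 1` steps.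
  set L := n / 3 - 1 with hL
  have hW : (startEdges k n).card ≤ 22500 * (k + 1) ^ 2 * (L + 1) ^ 2 := by
    refine (card_edgesIn_le _).trans ?_
    rw [card_window]
    have h1 : ((3 * n + 1 + 1 - (3 * n - 1) : ℤ)).toNat = 3 := by omega
    have h2 : ((4 * n + 1 + 1 - (-(3 * n) - 1) : ℤ)).toNat = 7 * n + 3 := by omega
    rw [h1, h2]
    have h3 : 3 * (7 * n + 3) ≤ 150 * (L + 1) := by omega
    calc (3 * (7 * n + 3) * (k + 1)) ^ 2 ≤ (150 * (L + 1) * (k + 1)) ^ 2 := by gcongr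
      _ = _ := by ring
  have hpow : (L + 1) ^ 2 ≤ 4 ^ (L + 1) := by
    have : L + 1 ≤ 2 ^ (L + 1) := Nat.lt_two_pow_self.le
    calc (L + 1) ^ 2 ≤ (2 ^ (L + 1)) ^ 2 := by gcongr
      _ = 4 ^ (L + 1) := by rw [← pow_mul, mul_comm (L + 1), pow_mul, show 2 ^ 2 = 4 from rfl]
  have hΔ1 : 1 ≤ Δ := Nat.one_le_pow _ _ (by omega)
  calc _ ≤ (bern (slab k).edgeSet p).real {ω | ∃ i ∈ startEdges k n, ∃ l : List (slab k).edgeSet,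
        l.length = L ∧ ((i :: l).IsChain fun a b => b ∈ nearEdges a) ∧ (i :: l).Nodup ∧
        ∀ j ∈ i :: l, ω j = b} := by
        refine measureReal_mono ?_
        rintro ω ⟨e₀, he₀, e₁, ⟨v, hv, hv'⟩, ⟨w, hw, hw'⟩, hb, hr⟩
        obtain ⟨l, h1, h2, h3⟩ := exists_nodup_isChain hr
        have hlen := abs_sub_le_of_isChain (fun e => (endpoint e).1.1)
          (fun i j hij => (hij.1 _ (endpoint_mem i) _ (endpoint_mem j)).1) e₀ l e₁ h1 h3
        have h4 := (abs_sub_le_one_of_mem hv (endpoint_mem e₀)).1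
        have h5 := (abs_sub_le_one_of_mem hw (endpoint_mem e₁)).1
        rw [abs_le] at h4 h5 hlen
        have hLl : L ≤ l.length := by omega
        have hpre : e₀ :: l.take L <+: e₀ :: l := by
          rw [List.cons_prefix_cons]; exact ⟨rfl, List.take_prefix _ _⟩
        refine ⟨e₀, he₀, l.take L, by simp [hLl], ?_, h2.sublist hpre.sublist, ?_⟩
        · exact (h1.prefix hpre).imp fun a b hab => mem_nearEdges hab.1
        · intro j hj
          obtain ⟨s, t, e⟩ := List.append_of_mem (hpre.subset hj)
          rcases List.eq_nil_or_concat s with rfl | ⟨s, u, rfl⟩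
          · simp at e; rw [← e.1]; exact hb
          · exact (rel_of_infix h1 (a := u) (b := j) ⟨s, t, by simp [e]⟩).2.2
    _ ≤ (startEdges k n).card * (Δ : ℕ) ^ L * q ^ (L + 1) :=
        bern_real_exists_chain_le _ p b card_nearEdges_le _ _
    _ ≤ (22500 * (k + 1) ^ 2 * 4 ^ (L + 1) : ℕ) * (Δ : ℝ) ^ (L + 1) * q ^ (L + 1) := by
        refine mul_le_mul_of_nonneg_right ?_ (by positivity)
        refine mul_le_mul ?_ ?_ (by positivity) (by positivity)
        · exact_mod_cast hW.trans (Nat.mul_le_mul_left _ hpow)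
        · exact pow_le_pow_right₀ (by exact_mod_cast hΔ1) (Nat.le_succ L)
    _ = 22500 * (k + 1) ^ 2 * (4 * Δ * q) ^ (L + 1) := by push_cast; ring
    _ ≤ 22500 * (k + 1) ^ 2 * (4 * Δ * q) := by
        refine mul_le_mul_of_nonneg_left ?_ (by positivity)
        exact pow_le_of_le_one (by positivity) hsmall.le (Nat.succ_ne_zero L)
    _ = chainConst k * q := by
        unfold chainConst; rw [← hΔ]; push_cast; ring

end slab

/-! ### Connection events as reachability, and coordinates of the boxes. -/

section connected

variable {k : ℕ}

@[simp] lemma mem_lift {E : Set (ℤ × ℤ)} {v : Vertex k} : v ∈ lift k E ↔ v.1 ∈ E := Iff.rfl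

lemma mem_connected_iff {B X Y : Set (ℤ × ℤ)} {ω : Config k} :
    ω ∈ connected k B X Y ↔
      ∃ x ∈ lift k X, ∃ y ∈ lift k Y, ReachIn (openGraph ω).Adj (lift k B) x y := by
  constructor
  · rintro ⟨C, ⟨x, hx, hxX⟩, y, hy, hyY⟩
    refine ⟨x, hxX, y, hyY, x.2, ?_⟩
    have hxy : ((openGraph ω).induce (lift k B)).Reachable x y := by
      rw [← SimpleGraph.ConnectedComponent.eq]
      exact hx.trans hy.symm
    rw [SimpleGraph.reachable_iff_reflTransGen] at hxy
    clear hy hyY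
    induction hxy with
    | refl => exact .refl
    | @tail a b _ hab ih => exact ih.tail ⟨hab, a.2, b.2⟩
  · rintro ⟨x, hx, y, hy, hxy⟩
    have key : ∃ h : y ∈ lift k B,
        ((openGraph ω).induce (lift k B)).Reachable ⟨x, hxy.left_mem⟩ ⟨y, h⟩ := by
      refine hxy.induct (p := fun y => ∃ h : y ∈ lift k B,
        ((openGraph ω).induce (lift k B)).Reachable ⟨x, hxy.left_mem⟩ ⟨y, h⟩)
        ⟨hxy.left_mem, .rfl⟩ ?_
      rintro v _ w hw hvw ⟨hv, hr⟩
      refine ⟨hw, hr.trans (SimpleGraph.Adj.reachable ?_)⟩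
      exact hvw
    obtain ⟨h, hr⟩ := key
    refine ⟨((openGraph ω).induce (lift k B)).connectedComponentMk ⟨x, hxy.left_mem⟩,
      ⟨_, rfl, hx⟩, ⟨y, h⟩, ?_, hy⟩
    exact SimpleGraph.ConnectedComponent.eq.2 hr.symm

lemma mem_box {n : ℕ} {v : ℤ × ℤ} :
    v ∈ box n ↔ (-(n : ℤ) ≤ v.1 ∧ v.1 ≤ n) ∧ -(n : ℤ) ≤ v.2 ∧ v.2 ≤ n := by
  rw [box, Set.mem_prod, Set.mem_Icc, Set.mem_Icc]

lemma mem_B' {y : ℕ → ℕ} {n : ℕ} {v : ℤ × ℤ} : v ∈ B' y n ↔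
    ((n : ℤ) ≤ v.1 ∧ v.1 ≤ 3 * n) ∧ (y (3 * n) : ℤ) - n ≤ v.2 ∧ v.2 ≤ y (3 * n) + n := by
  rw [B', Set.mem_vadd_set_iff_neg_vadd_mem, mem_box]
  simp only [vadd_eq_add, Prod.fst_add, Prod.snd_add, Prod.fst_neg, Prod.snd_neg]
  omega

lemma mem_S' {u y : ℕ → ℕ} {n : ℕ} {v : ℤ × ℤ} : v ∈ S' u y n ↔
    (2 * (n : ℤ) - u n ≤ v.1 ∧ v.1 ≤ 2 * n + u n) ∧
      (y (3 * n) : ℤ) - u n ≤ v.2 ∧ v.2 ≤ y (3 * n) + u n := by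
  rw [S', Set.mem_vadd_set_iff_neg_vadd_mem, S, mem_box]
  simp only [vadd_eq_add, Prod.fst_add, Prod.snd_add, Prod.fst_neg, Prod.snd_neg]
  omega

lemma mem_Yplus {α y : ℕ → ℕ} {n : ℕ} {v : ℤ × ℤ} : v ∈ Yplus α y n ↔
    v.1 = 3 * n ∧ (y (3 * n) : ℤ) + α n ≤ v.2 ∧ v.2 ≤ y (3 * n) + n := by
  simp [Yplus, Set.mem_prod]

lemma mem_Yminus {α y : ℕ → ℕ} {n : ℕ} {v : ℤ × ℤ} : v ∈ Yminus α y n ↔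
    v.1 = 3 * n ∧ (y (3 * n) : ℤ) - n ≤ v.2 ∧ v.2 ≤ y (3 * n) - α n := by
  simp [Yminus, Set.mem_prod]

lemma mem_Z {α y : ℕ → ℕ} {n : ℕ} {v : ℤ × ℤ} : v ∈ Z α y n ↔
    v.1 = 3 * n ∧ (y (3 * n) : ℤ) - α n ≤ v.2 ∧ v.2 ≤ y (3 * n) + α n := by
  simp [Z, Set.mem_prod]

/-- The union of the boxes `B₃ₙ` and `Bₙ'`. -/
def region (y : ℕ → ℕ) (n : ℕ) : Set (ℤ × ℤ) := box (3 * n) ∪ B' y n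

lemma mem_region {y : ℕ → ℕ} {n : ℕ} {v : ℤ × ℤ} : v ∈ region y n ↔
    (-(3 * (n : ℤ)) ≤ v.1 ∧ v.1 ≤ 3 * n ∧ -(3 * (n : ℤ)) ≤ v.2 ∧ v.2 ≤ 3 * n) ∨
    ((n : ℤ) ≤ v.1 ∧ v.1 ≤ 3 * n ∧ (y (3 * n) : ℤ) - n ≤ v.2 ∧ v.2 ≤ y (3 * n) + n) := by
  rw [region, Set.mem_union, mem_box, mem_B']
  push_cast
  simp only [and_assoc]

lemma near_of_mem {e f : (slab k).edgeSet} {v : Vertex k} (he : v ∈ e.1) (hf : v ∈ f.1) :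
    Near e f := by
  intro a ha b hb
  have h1 := abs_sub_le_one_of_mem ha he
  have h2 := abs_sub_le_one_of_mem hf hb
  simp only [abs_le] at h1 h2 ⊢
  omega

lemma mem_startEdges {y : ℕ → ℕ} {n : ℕ} (hy : y (3 * n) ≤ 3 * n) {e : (slab k).edgeSet}
    {v : Vertex k} (hv : v ∈ e.1) (hx : v.1.1 = 3 * n) (hR : v.1 ∈ region y n) :
    e ∈ startEdges k n := by
  rw [startEdges, mem_edgesIn]
  intro w hw
  have h1 := abs_sub_le_one_of_mem hv hw
  simp only [abs_le] at h1
  rw [mem_region] at hR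
  rw [mem_window]
  omega

lemma openGraph_symm {ω : Config k} (v w : Vertex k) (h : (openGraph ω).Adj v w) :
    (openGraph ω).Adj w v := h.symm

/-- An open path from `x ≤ x₀` to the line `x = 3n` yields a chain of open edges. -/
lemma linked_of_reach {y : ℕ → ℕ} {n : ℕ} (hy : y (3 * n) ≤ 3 * n) {x₀ : ℤ} {ω : Config k}
    {a b : Vertex k} (h : ReachIn (openGraph ω).Adj (lift k (region y n)) a b)
    (ha : a.1.1 ≤ x₀) (hx : x₀ < 3 * n) (hb : b.1.1 = 3 * n) : Linked true n x₀ ω := by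
  have hr := h.symm openGraph_symm
  have key : a = b ∨ ∃ e₀ e₁ : (slab k).edgeSet, b ∈ e₀.1 ∧ a ∈ e₁.1 ∧
      ReachIn Near {e | ω e = true} e₀ e₁ := by
    refine hr.induct (p := fun a => a = b ∨ ∃ e₀ e₁ : (slab k).edgeSet, b ∈ e₀.1 ∧ a ∈ e₁.1 ∧
      ReachIn Near {e | ω e = true} e₀ e₁) (.inl rfl) ?_
    rintro v _ w _ ⟨he, ho⟩ (rfl | ⟨e₀, e₁, h0, h1, hre⟩)
    · exact .inr ⟨⟨_, he⟩, ⟨_, he⟩, by simp, by simp, .refl ho⟩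
    · refine .inr ⟨e₀, ⟨_, he⟩, h0, by simp, hre.tail (near_of_mem h1 (by simp)) ho⟩
  rcases key with rfl | ⟨e₀, e₁, h0, h1, hre⟩
  · omega
  · exact ⟨e₀, mem_startEdges hy h0 hb hr.left_mem, e₁, ⟨b, h0, hb⟩, ⟨a, h1, ha⟩, hre⟩

end connected

lemma reachIn_of_le {V : Type*} {r : V → V → Prop} {A : Set V} (f : ℤ → V) {a b : ℤ} (hab : a ≤ b)
    (hA : ∀ i, a ≤ i → i ≤ b → f i ∈ A) (hr : ∀ i, a ≤ i → i < b → r (f i) (f (i + 1))) :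
    ReachIn r A (f a) (f b) := by
  induction b, hab using Int.leInduction with
  | base => exact .refl (hA a le_rfl le_rfl)
  | succ b hab ih =>
    refine (ih (fun i h1 h2 => hA i h1 (by omega)) fun i h1 h2 => hr i h1 (by omega)).tail
      (hr b hab (by omega)) (hA _ (by omega) le_rfl)

lemma reachIn_line {V : Type*} {r : V → V → Prop} (hs : ∀ v w, r v w → r w v) {A : Set V}
    (f : ℤ → V) (a b : ℤ) (hA : ∀ i, min a b ≤ i → i ≤ max a b → f i ∈ A)
    (hr : ∀ i, r (f i) (f (i + 1))) : ReachIn r A (f a) (f b) := by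
  rcases le_total a b with h | h
  · exact reachIn_of_le f h (fun i h1 h2 => hA i (by omega) (by omega)) fun i _ _ => hr i
  · exact (reachIn_of_le f h (fun i h1 h2 => hA i (by omega) (by omega)) fun i _ _ => hr i).symm hs

section slab

variable {k : ℕ}

lemma slab_adj_right (x v : ℤ) (i : Fin (k + 1)) : (slab k).Adj ((x, v), i) ((x + 1, v), i) := by
  simp [slab]

lemma slab_adj_up (x v : ℤ) (i : Fin (k + 1)) : (slab k).Adj ((x, v), i) ((x, v + 1), i) := by
  simp [slab]

lemma reachIn_column (z : ℤ × ℤ) (i j : Fin (k + 1)) :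
    ReachIn (slab k).Adj {v | v.1 = z} (z, i) (z, j) := by
  have key : ∀ m (hm : m < k + 1), ReachIn (slab k).Adj {v | v.1 = z} (z, 0) (z, ⟨m, hm⟩) := by
    intro m
    induction m with
    | zero => intro _; exact .refl rfl
    | succ m ih =>
      intro hm
      refine (ih (by omega)).tail ?_ rfl
      simp [slab]
  exact ((key i i.2).symm fun _ _ h => h.symm).trans (key j j.2)

lemma slab_adj_cases {a b : Vertex k} (h : (slab k).Adj a b) :
    a.1.1 = b.1.1 ∨ b = ((a.1.1 + 1, a.1.2), a.2) ∨ a = ((b.1.1 + 1, b.1.2), b.2) := by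
  obtain ⟨⟨a1, a2⟩, a3⟩ := a
  obtain ⟨⟨b1, b2⟩, b3⟩ := b
  have h' : |a1 - b1| + |a2 - b2| + |((a3 : ℕ) : ℤ) - ((b3 : ℕ) : ℤ)| = 1 := h
  have h1 := abs_nonneg (a2 - b2)
  have h2 := abs_nonneg (((a3 : ℕ) : ℤ) - ((b3 : ℕ) : ℤ))
  by_cases hx : a1 = b1
  · exact .inl hx
  · right
    have h3 : 1 ≤ |a1 - b1| := Int.one_le_abs (by omega)
    have h4 : a2 - b2 = 0 := abs_eq_zero.1 (by omega)
    have h5 : ((a3 : ℕ) : ℤ) - ((b3 : ℕ) : ℤ) = 0 := abs_eq_zero.1 (by omega)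
    have h6 : a3 = b3 := Fin.ext (by omega)
    have h7 : |a1 - b1| = 1 := by omega
    have h8 : a2 = b2 := by omega
    subst h6 h8
    rcases (abs_eq (by norm_num)).1 h7 with h | h
    · right; simp; omega
    · left; simp; omega

lemma planarStep_of_adj {a b : Vertex k} (h : (slab k).Adj a b) : PlanarStep a.1 b.1 := by
  have h' : |a.1.1 - b.1.1| + |a.1.2 - b.1.2| + |((a.2 : ℕ) : ℤ) - ((b.2 : ℕ) : ℤ)| = 1 := h
  have h2 := abs_nonneg (((a.2 : ℕ) : ℤ) - ((b.2 : ℕ) : ℤ))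
  unfold PlanarStep
  omega

end slab

/-! ### Boundaries of clusters as cocycles modulo 2. -/

section contour

variable {k : ℕ} (R C : Set (Vertex k)) (W : Set (slab k).edgeSet)

/-- The edges within `R` that leave `C`. -/
def boundaryEdges : Set (slab k).edgeSet :=
  {e | ∃ a ∈ R, ∃ b ∈ R, a ∈ C ∧ b ∉ C ∧ e.1 = s(a, b)}

open Classical in
/-- The indicator modulo 2 of the edges in `W`. -/
noncomputable def edgeInd (a b : Vertex k) : ZMod 2 :=
  if ∃ h : s(a, b) ∈ (slab k).edgeSet, ⟨s(a, b), h⟩ ∈ W then 1 else 0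

open Classical in
/-- The indicator modulo 2 of `C`. -/
noncomputable def vertInd (a : Vertex k) : ZMod 2 := if a ∈ C then 1 else 0

/-- The number modulo 2 of edges of `W` on the horizontal line from the plane `x = x₀`. -/
noncomputable def potential (x₀ : ℤ) (v : Vertex k) : ZMod 2 :=
  ∑ j ∈ Finset.range (v.1.1 - x₀).toNat,
    edgeInd W ((x₀ + j, v.1.2), v.2) ((x₀ + j + 1, v.1.2), v.2)

variable {R C W}

lemma edgeInd_comm (a b : Vertex k) : edgeInd W a b = edgeInd W b a := by
  unfold edgeInd
  congr 1
  rw [Sym2.eq_swap]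

lemma edgeInd_of_mem {a b : Vertex k} (h : (slab k).Adj a b)
    (hW : (⟨s(a, b), h⟩ : (slab k).edgeSet) ∈ W) : edgeInd W a b = 1 := if_pos ⟨h, hW⟩

lemma edgeInd_of_not_mem {a b : Vertex k} (h : (slab k).Adj a b)
    (hW : (⟨s(a, b), h⟩ : (slab k).edgeSet) ∉ W) : edgeInd W a b = 0 :=
  if_neg fun ⟨_, h'⟩ => hW h'

lemma vertInd_add {a b : Vertex k} (h : (slab k).Adj a b) (ha : a ∈ R) (hb : b ∈ R) :
    vertInd C a + vertInd C b =
      edgeInd (boundaryEdges R C) a b := by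
  have h11 : (1 : ZMod 2) + 1 = 0 := by decide
  by_cases hab : (⟨s(a, b), h⟩ : (slab k).edgeSet) ∈ boundaryEdges R C
  · rw [edgeInd_of_mem h hab]
    obtain ⟨a', _, b', _, h1, h2, e⟩ := hab
    rcases Sym2.eq_iff.1 e with ⟨rfl, rfl⟩ | ⟨rfl, rfl⟩
    · simp [vertInd, h1, h2]
    · simp [vertInd, h1, h2]
  · rw [edgeInd_of_not_mem h hab]
    by_cases h1 : a ∈ C <;> by_cases h2 : b ∈ C
    · simp [vertInd, h1, h2, h11]
    · exact (hab ⟨a, ha, b, hb, h1, h2, rfl⟩).elim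
    · exact (hab ⟨b, hb, a, ha, h2, h1, Sym2.eq_swap⟩).elim
    · simp [vertInd, h1, h2]

variable (hWb : W ⊆ boundaryEdges R C)
  (hWn : ∀ e ∈ W, ∀ f ∈ boundaryEdges R C, Near e f → f ∈ W)
include hWb hWn

lemma edgeInd_eq_of_near {a b : Vertex k} (h : (slab k).Adj a b) (ha : a ∈ R) (hb : b ∈ R)
    {e : (slab k).edgeSet} (he : e ∈ W) (hn : Near e ⟨s(a, b), h⟩) :
    edgeInd W a b = vertInd C a + vertInd C b := by
  rw [vertInd_add h ha hb]
  by_cases hab : (⟨s(a, b), h⟩ : (slab k).edgeSet) ∈ boundaryEdges R C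
  · rw [edgeInd_of_mem h (hWn e he _ hab hn), edgeInd_of_mem h hab]
  · rw [edgeInd_of_not_mem h fun h' => hab (hWb h'), edgeInd_of_not_mem h hab]

/-- `W` is a cocycle. If one of its edges is near all four sides, `W` agrees on them with the
boundary of `C`, whose indicator is a coboundary. Otherwise none of the sides is in `W`, because the
sides of a square are near each other. -/
lemma edgeInd_square {a b a' b' : Vertex k} (hab : (slab k).Adj a b) (hbb : (slab k).Adj b b')
    (hab' : (slab k).Adj a' b') (haa : (slab k).Adj a a') (ha : a ∈ R) (hb : b ∈ R)
    (ha' : a' ∈ R) (hb' : b' ∈ R) (c : ℤ × ℤ)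
    (hd : ∀ v : Vertex k, (v = a ∨ v = b ∨ v = a' ∨ v = b') →
      |v.1.1 - c.1| ≤ 1 ∧ |v.1.2 - c.2| ≤ 1) :
    edgeInd W a b + edgeInd W b b' + edgeInd W a' b' + edgeInd W a a' = 0 := by
  by_cases hex : ∃ e ∈ W, Near e ⟨s(a, b), hab⟩ ∧ Near e ⟨s(b, b'), hbb⟩ ∧
      Near e ⟨s(a', b'), hab'⟩ ∧ Near e ⟨s(a, a'), haa⟩
  · obtain ⟨e, he, h1, h2, h3, h4⟩ := hex
    rw [edgeInd_eq_of_near hWb hWn hab ha hb he h1, edgeInd_eq_of_near hWb hWn hbb hb hb' he h2,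
      edgeInd_eq_of_near hWb hWn hab' ha' hb' he h3, edgeInd_eq_of_near hWb hWn haa ha ha' he h4]
    generalize vertInd C a = x
    generalize vertInd C b = y
    generalize vertInd C a' = z
    generalize vertInd C b' = w
    revert x y z w; decide
  · have hnear : ∀ e f : (slab k).edgeSet, (∀ v ∈ e.1, v = a ∨ v = b ∨ v = a' ∨ v = b') →
        (∀ v ∈ f.1, v = a ∨ v = b ∨ v = a' ∨ v = b') → Near e f := by
      intro e f he hf v hv w hw
      have h1 := hd v (he v hv)
      have h2 := hd w (hf w hw)
      simp only [abs_le] at h1 h2 ⊢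
      omega
    have hz : ∀ c d : Vertex k, (h : (slab k).Adj c d) → (c = a ∨ c = b ∨ c = a' ∨ c = b') →
        (d = a ∨ d = b ∨ d = a' ∨ d = b') → edgeInd W c d = 0 := by
      intro c d h hc hd
      refine edgeInd_of_not_mem h fun hW => hex ⟨_, hW, ?_⟩
      have hl : ∀ v ∈ s(c, d), v = a ∨ v = b ∨ v = a' ∨ v = b' := by
        intro v hv
        rcases Sym2.mem_iff.1 hv with rfl | rfl
        · exact hc
        · exact hd
      refine ⟨hnear _ _ hl ?_, hnear _ _ hl ?_, hnear _ _ hl ?_, hnear _ _ hl ?_⟩ <;>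
      · intro v hv
        rcases Sym2.mem_iff.1 hv with rfl | rfl <;> simp
    rw [hz a b hab (by simp) (by simp), hz b b' hbb (by simp) (by simp),
      hz a' b' hab' (by simp) (by simp), hz a a' haa (by simp) (by simp)]
    simp

omit hWb hWn

lemma potential_of_le {x₀ : ℤ} {v : Vertex k} (h : v.1.1 ≤ x₀) : potential W x₀ v = 0 := by
  unfold potential
  rw [Int.toNat_of_nonpos (by omega), Finset.range_zero, Finset.sum_empty]

lemma potential_right {x₀ x : ℤ} (h : x₀ ≤ x) (y : ℤ) (i : Fin (k + 1)) :
    potential W x₀ ((x + 1, y), i) =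
      potential W x₀ ((x, y), i) + edgeInd W ((x, y), i) ((x + 1, y), i) := by
  unfold potential
  have e : (x + 1 - x₀).toNat = (x - x₀).toNat + 1 := by omega
  dsimp only
  rw [e, Finset.sum_range_succ]
  have e2 : x₀ + ((x - x₀).toNat : ℤ) = x := by omega
  rw [e2]

include hWb hWn

variable {x₀ : ℤ} (hRx : ∀ x y i, x₀ ≤ x → ((x + 1, y), i) ∈ R → ((x, y), i) ∈ R)
  (hWx : ∀ e ∈ W, ∀ v ∈ e.1, x₀ < v.1.1)
include hRx hWx

/-- At `x = x₀` everything vanishes because `W` lies strictly to the right. Moving the edge one unit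
to the right sweeps a square, and `edgeInd_square` carries the identity over. -/
lemma potential_add_of_eq {a b : Vertex k} (h : (slab k).Adj a b) (hx : a.1.1 = b.1.1)
    (ha : a ∈ R) (hb : b ∈ R) : potential W x₀ a + potential W x₀ b = edgeInd W a b := by
  obtain ⟨⟨x, ya⟩, i⟩ := a
  obtain ⟨⟨x', yb⟩, j⟩ := b
  obtain rfl : x = x' := hx
  have hadj : ∀ x' : ℤ, (slab k).Adj ((x', ya), i) ((x', yb), j) := fun x' => by
    have : |x - x| + |ya - yb| + |((i : ℕ) : ℤ) - ((j : ℕ) : ℤ)| = 1 := h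
    change |x' - x'| + |ya - yb| + |((i : ℕ) : ℤ) - ((j : ℕ) : ℤ)| = 1
    simpa using this
  have hle : ∀ x : ℤ, x ≤ x₀ → potential W x₀ ((x, ya), i) + potential W x₀ ((x, yb), j) =
      edgeInd W ((x, ya), i) ((x, yb), j) := by
    intro x hx
    rw [potential_of_le (by exact hx), potential_of_le (by exact hx), edgeInd_of_not_mem (hadj x)]
    · simp
    · intro hW
      have := hWx _ hW ((x, ya), i) (by simp)
      exact absurd hx (not_le.2 this)
  rcases le_total x x₀ with hxx | hxx
  · exact hle x hxx
  · clear h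
    induction x, hxx using Int.leInduction with
    | base => exact hle x₀ le_rfl
    | succ x hx ih =>
      have ha' := hRx x ya i hx ha
      have hb' := hRx x yb j hx hb
      have h1 := ih ha' hb'
      have h2 := edgeInd_square hWb hWn (hadj x) (slab_adj_right x yb j) (hadj (x + 1))
        (slab_adj_right x ya i) ha' hb' ha hb (x, ya) (by
          have h3 := planarStep_of_adj (hadj x)
          unfold PlanarStep at h3
          dsimp only at h3
          rw [sub_self, abs_zero, zero_add, abs_sub_comm] at h3
          rintro v (rfl | rfl | rfl | rfl) <;> simp [h3])
      rw [potential_right hx, potential_right hx]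
      revert h1 h2
      generalize edgeInd W ((x, ya), i) ((x, yb), j) = t1
      generalize edgeInd W ((x, yb), j) ((x + 1, yb), j) = t2
      generalize edgeInd W ((x + 1, ya), i) ((x + 1, yb), j) = t3
      generalize edgeInd W ((x, ya), i) ((x + 1, ya), i) = t4
      generalize potential W x₀ ((x, ya), i) = t5
      generalize potential W x₀ ((x, yb), j) = t6
      revert t1 t2 t3 t4 t5 t6
      decide

lemma potential_add {a b : Vertex k} (h : (slab k).Adj a b) (ha : a ∈ R) (hb : b ∈ R) :
    potential W x₀ a + potential W x₀ b = edgeInd W a b := by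
  have hright : ∀ a b : Vertex k, (slab k).Adj a b → b = ((a.1.1 + 1, a.1.2), a.2) →
      potential W x₀ a + potential W x₀ b = edgeInd W a b := by
    rintro a b h rfl
    rcases lt_or_ge a.1.1 x₀ with hlt | hge
    · rw [potential_of_le hlt.le, potential_of_le (by exact hlt), edgeInd_of_not_mem h]
      · simp
      · intro hW
        have := hWx _ hW a (by simp)
        exact absurd hlt (not_lt.2 this.le)
    · obtain ⟨⟨x, y⟩, i⟩ := a
      dsimp only
      rw [potential_right hge]
      generalize edgeInd W ((x, y), i) ((x + 1, y), i) = t1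
      generalize potential W x₀ ((x, y), i) = t2
      revert t1 t2; decide
  rcases slab_adj_cases h with he | he | he
  · exact potential_add_of_eq hWb hWn hRx hWx h he ha hb
  · exact hright a b h he
  · rw [add_comm, edgeInd_comm]
    exact hright b a h.symm he

omit hRx hWx hWb hWn

lemma zmod_two_eq_of_add {a b : ZMod 2} (h : a + b = 0) : b = a := by
  revert a b; decide

end contour

/-- If the cluster of `S₃ₙ` meets the line `x = 3n` but not the cluster of a point with `x ≤ x₀`
which meets that line as well, then the two are separated by a chain of closed edges. -/
theorem linked_of_separated {k : ℕ} {y : ℕ → ℕ} {n : ℕ} (hy : y (3 * n) ≤ 3 * n) {x₀ : ℤ}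
    (hn : (n : ℤ) ≤ x₀) {ω : Config k} {s z s' y' : Vertex k}
    (hsz : ReachIn (openGraph ω).Adj (lift k (region y n)) s z)
    (hsy : ReachIn (openGraph ω).Adj (lift k (region y n)) s' y')
    (hsep : ¬ ReachIn (openGraph ω).Adj (lift k (region y n)) s s')
    (hs : s.1.1 ≤ x₀) (hs' : s'.1.1 ≤ x₀) (hz : z.1.1 = 3 * n) (hy' : y'.1.1 = 3 * n) :
    Linked false n x₀ ω := by
  by_contra hL
  set R := lift k (region y n) with hR
  set C : Set (Vertex k) := {v | ReachIn (openGraph ω).Adj R s v} with hC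
  -- The part of the boundary of `C` chained to the line `x = 3n`. If no closed chain reaches `x ≤
  -- x₀`, it stays in `x > x₀` and is the coboundary of `potential`.
  set W : Set (slab k).edgeSet := {e | ∃ e₀ ∈ startEdges k n, (∃ v ∈ e₀.1, v.1.1 = 3 * n) ∧
    ReachIn Near (boundaryEdges R C) e₀ e} with hW
  have hCl : ∀ a ∈ C, ∀ b ∈ R, (openGraph ω).Adj a b → b ∈ C := fun a ha b hb h =>
    ReachIn.tail ha h hb
  have hclosed : boundaryEdges R C ⊆ {e | ω e = false} := by
    rintro ⟨e, he⟩ ⟨a, _, b, hb, h1, h2, rfl⟩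
    by_contra ho
    exact h2 (hCl a h1 b hb ⟨he, by simpa using ho⟩)
  have hWb : W ⊆ boundaryEdges R C := by
    rintro e ⟨e₀, _, _, h⟩
    exact h.right_mem
  have hWn : ∀ e ∈ W, ∀ f ∈ boundaryEdges R C, Near e f → f ∈ W := by
    rintro e ⟨e₀, h0, h1, h⟩ f hf hn
    exact ⟨e₀, h0, h1, h.tail hn hf⟩
  -- Both boxes extend to the left at least as far as `x = n`, and `n ≤ x₀`.
  have hRx : ∀ x y i, x₀ ≤ x → ((x + 1, y), i) ∈ R → ((x, y), i) ∈ R := by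
    intro x y i hx h
    rw [hR, mem_lift, mem_region] at h ⊢
    dsimp only at h ⊢
    omega
  have hWx : ∀ e ∈ W, ∀ v ∈ e.1, x₀ < v.1.1 := by
    rintro e ⟨e₀, h0, h1, h⟩ v hv
    by_contra hle
    exact hL ⟨e₀, h0, e, h1, ⟨v, hv, not_lt.1 hle⟩, h.mono (fun _ _ _ _ h => h) hclosed⟩
  have hpot := fun a b h ha hb => potential_add hWb hWn hRx hWx (a := a) (b := b) h ha hb
  have hopen : ∀ a ∈ R, ∀ b ∈ R, (openGraph ω).Adj a b →
      potential W x₀ b = potential W x₀ a := by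
    rintro a ha b hb ⟨h, ho⟩
    refine zmod_two_eq_of_add ?_
    rw [hpot a b h ha hb, edgeInd_of_not_mem h]
    intro hmem
    have := hclosed (hWb hmem)
    simp [ho] at this
  have hpz : potential W x₀ z = 0 :=
    hsz.induct (p := fun v => potential W x₀ v = 0) (potential_of_le hs)
      fun a ha b hb h hp => (hopen a ha b hb h).trans hp
  have hpy : potential W x₀ y' = 0 :=
    hsy.induct (p := fun v => potential W x₀ v = 0) (potential_of_le hs')
      fun a ha b hb h hp => (hopen a ha b hb h).trans hp
  have hyC : y' ∉ C := fun h => hsep (h.trans (hsy.symm openGraph_symm))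
  have hline : ReachIn (slab k).Adj (R ∩ {v | v.1.1 = 3 * n}) z y' := by
    have hzR := hsz.right_mem
    have hyR := hsy.right_mem
    obtain ⟨⟨zx, zy⟩, zi⟩ := z
    obtain ⟨⟨yx, yy⟩, yi⟩ := y'
    obtain rfl : zx = 3 * n := hz
    obtain rfl : yx = 3 * n := hy'
    have h1 : ReachIn (slab k).Adj (R ∩ {v | v.1.1 = 3 * n}) ((3 * (n : ℤ), zy), zi)
        ((3 * (n : ℤ), yy), zi) := by
      refine reachIn_line (fun _ _ h => h.symm) (fun v => ((3 * (n : ℤ), v), zi)) zy yy ?_ ?_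
      · intro v hv1 hv2
        refine ⟨?_, rfl⟩
        rw [hR, mem_lift, mem_region] at hzR hyR ⊢
        dsimp only at hzR hyR ⊢
        omega
      · exact fun v => slab_adj_up _ _ _
    refine h1.trans ((reachIn_column (3 * (n : ℤ), yy) zi yi).mono (fun _ _ _ _ h => h) ?_)
    rintro ⟨v, i⟩ hv
    obtain rfl : v = (3 * (n : ℤ), yy) := hv
    exact ⟨hyR, rfl⟩
  -- On the line `x = 3n` every boundary edge belongs to `W`, so the potential and the indicator of
  -- `C` change together. Yet the potential is `0` at both `z` and `y'`, while only `z` is in `C`.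
  have hfin : potential W x₀ y' + vertInd C y' = potential W x₀ z + vertInd C z := by
    refine hline.induct
      (p := fun v => potential W x₀ v + vertInd C v = potential W x₀ z + vertInd C z) rfl ?_
    rintro a ⟨ha, hax⟩ b ⟨hb, hbx⟩ hab hp
    rw [← hp]
    have h1 := hpot a b hab ha hb
    have h2 := vertInd_add (C := C) hab ha hb
    have h3 : edgeInd W a b = edgeInd (boundaryEdges R C) a b := by
      by_cases hmem : (⟨s(a, b), hab⟩ : (slab k).edgeSet) ∈ boundaryEdges R C
      · rw [edgeInd_of_mem hab hmem, edgeInd_of_mem hab]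
        exact ⟨_, mem_startEdges hy (v := a) (by simp) hax ha, ⟨a, by simp, hax⟩, .refl hmem⟩
      · rw [edgeInd_of_not_mem hab hmem, edgeInd_of_not_mem hab fun h => hmem (hWb h)]
    rw [h3, ← h2] at h1
    revert h1
    generalize potential W x₀ a = t1
    generalize potential W x₀ b = t2
    generalize vertInd C a = t3
    generalize vertInd C b = t4
    revert t1 t2 t3 t4
    decide
  rw [hpz, hpy, vertInd, vertInd, if_neg hyC, if_pos (show z ∈ C from hsz)] at hfin
  exact absurd hfin (by decide)

/-! ### The slab as an instance of the abstract setup. -/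

lemma ReachIn.map {V W : Type*} {r : V → V → Prop} {r' : W → W → Prop} {A : Set V} {A' : Set W}
    (f : V → W) {x y : V} (h : ReachIn r A x y) (hr : ∀ v ∈ A, ∀ w ∈ A, r v w → r' (f v) (f w))
    (hA : ∀ v ∈ A, f v ∈ A') : ReachIn r' A' (f x) (f y) :=
  h.induct (p := fun y => ReachIn r' A' (f x) (f y)) (.refl (hA x h.left_mem))
    fun v hv w hw hvw hp => hp.tail (hr v hv w hw hvw) (hA w hw)

lemma ReachIn.toSubtype {V : Type*} {r : V → V → Prop} {A B : Set V} (hAB : A ⊆ B) {x y : V}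
    (h : ReachIn r A x y) : ∃ (hx : x ∈ B) (hy : y ∈ B),
      ReachIn (fun v w : B => r v w) {v | v.1 ∈ A} ⟨x, hx⟩ ⟨y, hy⟩ := by
  refine ⟨hAB h.left_mem, ?_⟩
  refine h.induct (p := fun y => ∃ hy : y ∈ B,
      ReachIn (fun v w : B => r v w) {v | v.1 ∈ A} ⟨x, hAB h.left_mem⟩ ⟨y, hy⟩)
    ⟨hAB h.left_mem, .refl h.left_mem⟩ ?_
  rintro v hv w hw hvw ⟨_, hp⟩
  exact ⟨hAB hw, hp.tail hvw hw⟩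

lemma reachIn_of_isChain {V : Type*} {r : V → V → Prop} : ∀ {a : V} {t : List V} {b : V},
    (a :: t).IsChain r → (a :: t).getLast? = some b → ReachIn r {v | v ∈ a :: t} a b
  | a, [], b, _, h => by
    simp at h; subst h; exact .refl (by simp)
  | a, c :: t, b, hc, h => by
    rw [List.isChain_cons_cons] at hc
    have ih := reachIn_of_isChain hc.2 (by simpa [List.getLast?_cons] using h)
    have h1 : ReachIn r {v | v ∈ a :: c :: t} a c :=
      (ReachIn.refl (by simp)).tail hc.1 (by simp)
    exact h1.trans (ih.mono (fun _ _ _ _ h => h) fun v hv => List.mem_cons_of_mem _ hv)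

section geometry

variable (k : ℕ) (u α y : ℕ → ℕ) (n : ℕ)

/-- The vertices over the union of the two boxes. -/
abbrev RegionVertex : Type := lift k (region y n)

instance : Finite (RegionVertex k y n) := by
  have h1 : (region y n).Finite := by
    refine ((Set.finite_Icc (-(3 * n : ℤ)) (3 * n)).prod
      (Set.finite_Icc (-(3 * n : ℤ) - n) (3 * n + y (3 * n) + n))).subset ?_
    intro v hv
    rw [mem_region] at hv
    rw [Set.mem_prod, Set.mem_Icc, Set.mem_Icc]
    omega
  have h2 : lift k (region y n) ⊆ (region y n) ×ˢ Set.univ := fun v hv => ⟨hv, trivial⟩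
  exact ((h1.prod Set.finite_univ).subset h2).to_subtype

noncomputable instance : Fintype (RegionVertex k y n) := Fintype.ofFinite _

/-- The geometric setting of the gluing lemma. -/
def slabSetup : Setup (RegionVertex k y n) (ℤ × ℤ) where
  G := (slab k).induce (lift k (region y n))
  col v := v.1.1
  B₁ := {v | v.1.1 ∈ box (3 * n)}
  B₂ := {v | v.1.1 ∈ B' y n}
  S := {v | v.1.1 ∈ S u (3 * n)}
  T := {v | v.1.1 ∈ Z α y n}
  S' := {v | v.1.1 ∈ S' u y n}
  Ym := {v | v.1.1 ∈ Yminus α y n}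
  Yp := {v | v.1.1 ∈ Yplus α y n}

variable {k u α y n}

lemma planarStep_symm (v w : ℤ × ℤ) (h : PlanarStep v w) : PlanarStep w v := by
  unfold PlanarStep at *
  rwa [abs_sub_comm, abs_sub_comm w.2]

lemma reachIn_S' {A : Set (ℤ × ℤ)} (hA : S' u y n ⊆ A) {s₁ s₂ : ℤ × ℤ} (h₁ : s₁ ∈ S' u y n)
    (h₂ : s₂ ∈ S' u y n) : ReachIn PlanarStep A s₁ s₂ := by
  obtain ⟨a1, b1⟩ := s₁
  obtain ⟨a2, b2⟩ := s₂
  rw [mem_S'] at h₁ h₂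
  dsimp only at h₁ h₂
  refine (reachIn_line planarStep_symm (fun i => (i, b1)) a1 a2 (fun i h1 h2 => hA ?_)
    fun i => ?_).trans (reachIn_line planarStep_symm (fun i => (a2, i)) b1 b2
      (fun i h1 h2 => hA ?_) fun i => ?_)
  · rw [mem_S']; dsimp only; omega
  · simp [PlanarStep]
  · rw [mem_S']; dsimp only; omega
  · simp [PlanarStep]

lemma planar_slabSetup (hu : ∀ m, 3 * u m ≤ m) : (slabSetup k u α y n).Planar where
  satS v x h hv := by
    change x.1.1 ∈ S u (3 * n)
    rw [← show v.1.1 = x.1.1 from h]; exact hv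
  satS' v x h hv := by
    change x.1.1 ∈ S' u y n
    rw [← show v.1.1 = x.1.1 from h]; exact hv
  column v x h := by
    obtain ⟨⟨z, i⟩, hv⟩ := v
    obtain ⟨⟨z', j⟩, hx⟩ := x
    obtain rfl : z = z' := h
    have hsub : {v : Vertex k | v.1 = z} ⊆ lift k (region y n) := by
      intro w hw
      rw [mem_lift, show w.1 = z from hw]
      exact hv
    obtain ⟨_, _, h'⟩ := (reachIn_column z i j).toSubtype hsub
    exact h'
  cross γ hγ hB hhead hlast hS' s₁ hs₁ s₂ hs₂ y₁ hy₁ y₂ hy₂ h₁ h₂ := by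
    obtain ⟨a, t, rfl, ha⟩ := hhead
    obtain ⟨b, hb, hbT⟩ := hlast
    set H : Set (ℤ × ℤ) := {q | ∃ v ∈ a :: t, v.1.1 = q} with hH
    set A : Set (ℤ × ℤ) := {q | q ∈ B' y n ∧ q ∉ H} with hA
    have hproj : ∀ {v w}, ReachIn (slabSetup k u α y n).G.Adj ((slabSetup k u α y n).B₂ ∩
        {v | ∀ g ∈ a :: t, (slabSetup k u α y n).col g ≠ (slabSetup k u α y n).col v}) v w →
        ReachIn PlanarStep A v.1.1 w.1.1 := by
      intro v w h
      refine h.map (fun v => v.1.1) (fun v _ w _ h => planarStep_of_adj h) ?_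
      rintro v ⟨hv, hv'⟩
      exact ⟨hv, fun ⟨g, hg, e⟩ => hv' g hg e⟩
    have hSA : S' u y n ⊆ A := by
      intro q hq
      refine ⟨?_, ?_⟩
      · have := hu n
        rw [mem_S'] at hq
        rw [mem_B']
        omega
      · rintro ⟨v, hv, rfl⟩
        exact hS' v hv hq
    have hpath : ReachIn PlanarStep A y₁.1.1 y₂.1.1 :=
      ((hproj h₁).symm planarStep_symm).trans ((reachIn_S' hSA hs₁ hs₂).trans (hproj h₂))
    have hcross : ReachIn PlanarStep H a.1.1 b.1.1 :=
      (reachIn_of_isChain hγ hb).map (A' := H) (fun v => v.1.1)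
        (fun v _ w _ h => planarStep_of_adj h)
        fun v hv => ⟨v, hv, rfl⟩
    have hy₁' := mem_Yminus.1 (show y₁.1.1 ∈ Yminus α y n from hy₁)
    have hy₂' := mem_Yplus.1 (show y₂.1.1 ∈ Yplus α y n from hy₂)
    have hb' := mem_Z.1 (show b.1.1 ∈ Z α y n from hbT)
    have ha' := mem_box.1 (show a.1.1 ∈ box (u (3 * n)) from ha)
    have hu3 := hu (3 * n)
    -- `S₃ₙ` lies in `x ≤ n` because `u (3 * n) ≤ n`, while `Bₙ'` begins at `x = n`: the crossing
    -- path starts to the left of the strip.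
    refine planar_paths_meet (xl := n) (xr := 3 * n) (fun v hv => hv.2) ?_ ?_ hpath hcross
      hy₁'.1 hy₂'.1 hb'.1 (by omega) (by omega) (by omega)
    · intro v hv
      exact (mem_B'.1 hv.1).1
    · rintro _ ⟨v, hv, rfl⟩
      have := mem_box.1 (show v.1.1 ∈ box (3 * n) from hB v hv)
      push_cast at this
      exact this.1.2

/-- The number of coordinates involved in a local modification. -/
def starConst (k : ℕ) : ℕ := 2 * (9 * (k + 1)) ^ 2

/-- Edges meeting a column and darts leaving it stay in a window of nine columns. The bound depends
on `k` alone, which is why `δ` does not depend on `n`. -/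
lemma card_star_le (z : ℤ × ℤ) : ((slabSetup k u α y n).star z).card ≤ starConst k := by
  classical
  set w := window k (z.1 - 1) (z.1 + 1) (z.2 - 1) (z.2 + 1) with hw
  have hwc : w.card = 9 * (k + 1) := by
    rw [hw, card_window]
    have h1 : (z.1 + 1 + 1 - (z.1 - 1)).toNat = 3 := by omega
    have h2 : (z.2 + 1 + 1 - (z.2 - 1)).toNat = 3 := by omega
    rw [h1, h2]
  have hadj : ∀ a b : Vertex k, (slab k).Adj a b → a.1 = z → a ∈ w ∧ b ∈ w := by
    intro a b h e
    have := abs_sub_le_one_of_mem (e := ⟨s(a, b), h⟩) (v := a) (w := b) (by simp) (by simp)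
    simp only [abs_le] at this
    rw [hw, mem_window, mem_window, ← e]
    omega
  set f : Coord (RegionVertex k y n) → Sym2 (Vertex k) ⊕ (Vertex k × Vertex k) :=
    Sum.map (Sym2.map Subtype.val) (Prod.map Subtype.val Subtype.val) with hf
  have hfinj : Function.Injective f :=
    (Sym2.map.injective Subtype.val_injective).sumMap
      (Subtype.val_injective.prodMap Subtype.val_injective)
  have hle : ((slabSetup k u α y n).star z).card ≤
      (((w ×ˢ w).image fun q => s(q.1, q.2)).disjSum (w ×ˢ w)).card := by
    refine Finset.card_le_card_of_injOn f ?_ hfinj.injOn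
    intro i hi
    rcases i with e | ⟨a, b⟩
    · obtain ⟨he, v, hv, hvz⟩ := Setup.inl_mem_star.1 hi
      induction e using Sym2.ind with | _ a b
      have hab : (slab k).Adj a.1 b.1 := he
      refine Finset.mem_coe.2 (Finset.inl_mem_disjSum.2 (Finset.mem_image.2 ⟨(a.1, b.1), ?_, rfl⟩))
      rw [Finset.mem_product]
      rcases Sym2.mem_iff.1 hv with rfl | rfl
      · exact hadj _ _ hab hvz
      · exact (hadj _ _ hab.symm hvz).symm
    · obtain ⟨haz, hab⟩ := Setup.inr_mem_star.1 hi
      refine Finset.mem_coe.2 (Finset.inr_mem_disjSum.2 ?_)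
      exact Finset.mem_product.2 (hadj _ _ hab haz)
  refine hle.trans ?_
  rw [Finset.card_disjSum]
  have h1 : ((w ×ˢ w).image fun q => s(q.1, q.2)).card ≤ (w ×ˢ w).card := Finset.card_image_le
  have h2 : (w ×ˢ w).card = (9 * (k + 1)) ^ 2 := by rw [Finset.card_product, hwc, sq]
  unfold starConst
  omega

end geometry

/-! ### Transfer between slab configurations and finite states. -/

section transfer

variable {k : ℕ} {u α y : ℕ → ℕ} {n : ℕ}

/-- The edges over the union of the two boxes. -/
abbrev RegionEdge (k : ℕ) (y : ℕ → ℕ) (n : ℕ) : Type :=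
  ((slab k).induce (lift k (region y n))).edgeSet

/-- An edge over the union of the two boxes, as an edge of the slab. -/
def toSlabEdge (e : RegionEdge k y n) : (slab k).edgeSet :=
  ⟨Sym2.map Subtype.val e.1, by
    obtain ⟨e, he⟩ := e
    induction e using Sym2.ind with | _ a b
    exact he⟩

/-- An edge over the union of the two boxes, as a coordinate. -/
def toCoord (e : RegionEdge k y n) : Coord (RegionVertex k y n) := .inl e.1

lemma toSlabEdge_injective : Function.Injective (toSlabEdge : RegionEdge k y n → _) := by
  intro e f h
  exact Subtype.ext (Sym2.map.injective Subtype.val_injective (congrArg Subtype.val h))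

lemma toCoord_injective : Function.Injective (toCoord : RegionEdge k y n → _) :=
  fun _ _ h => Subtype.ext (Sum.inl_injective h)

open Classical in
/-- The state with given open edges. -/
noncomputable def extend (ζ : RegionEdge k y n → Bool) : State (RegionVertex k y n)
  | .inl e => if h : e ∈ ((slab k).induce (lift k (region y n))).edgeSet then ζ ⟨e, h⟩ else false
  | .inr _ => false

lemma opn_extend_iff (ζ : RegionEdge k y n → Bool) (v w : RegionVertex k y n) :
    (slabSetup k u α y n).Opn (extend ζ) v w ↔
      ∃ h : s(v, w) ∈ ((slab k).induce (lift k (region y n))).edgeSet, ζ ⟨s(v, w), h⟩ = true := by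
  constructor
  · rintro ⟨h, ho⟩
    refine ⟨h, ?_⟩
    rw [extend, dif_pos (show s(v, w) ∈ _ from h)] at ho
    exact ho
  · rintro ⟨h, ho⟩
    refine ⟨h, ?_⟩
    rw [extend, dif_pos h]
    exact ho

/-- Passing through `extend` forgets the preference bits and the values at pairs that are not edges;
openness sees neither. -/
lemma opn_extend_coord (η : State (RegionVertex k y n)) :
    (slabSetup k u α y n).Opn (extend (η ∘ toCoord)) = (slabSetup k u α y n).Opn η := by
  funext v w
  rw [opn_extend_iff, eq_iff_iff]
  exact ⟨fun ⟨h, ho⟩ => ⟨h, ho⟩, fun ⟨h, ho⟩ => ⟨h, ho⟩⟩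

lemma opn_extend_slab (ω : Config k) :
    (slabSetup k u α y n).Opn (extend (ω ∘ toSlabEdge)) =
      fun v w => (openGraph ω).Adj v.1 w.1 := by
  funext v w
  rw [opn_extend_iff, eq_iff_iff]
  exact ⟨fun ⟨h, ho⟩ => ⟨h, ho⟩, fun ⟨h, ho⟩ => ⟨h, ho⟩⟩

lemma joins_extend_iff (ω : Config k) {B X Y : Set (ℤ × ℤ)} (hB : B ⊆ region y n) :
    (slabSetup k u α y n).Joins (extend (ω ∘ toSlabEdge)) {v | v.1.1 ∈ B} {v | v.1.1 ∈ X}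
      {v | v.1.1 ∈ Y} ↔ ω ∈ connected k B X Y := by
  rw [mem_connected_iff, Setup.Joins, opn_extend_slab]
  constructor
  · rintro ⟨a, ha, b, hb, h⟩
    exact ⟨a, ha, b, hb, h.map Subtype.val (fun _ _ _ _ h => h) fun _ h => h⟩
  · rintro ⟨a, ha, b, hb, h⟩
    obtain ⟨h1, h2, h'⟩ := h.toSubtype (B := lift k (region y n)) fun v hv => hB hv
    exact ⟨⟨a, h1⟩, ha, ⟨b, h2⟩, hb, h'⟩

variable (k u α y n)

/-- The event in the hypothesis of the gluing lemma. -/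
def hypEvent : Set (Config k) :=
  connected k (box (3 * n)) (S u (3 * n)) (Z α y n) ∩
    connected k (B' y n) (S' u y n) (Yminus α y n) ∩
    connected k (B' y n) (S' u y n) (Yplus α y n)

/-- The event in the conclusion of the gluing lemma. -/
def conclEvent : Set (Config k) :=
  connected k (box (3 * n) ∪ B' y n) (S u (3 * n)) (S' u y n)

variable {k u α y n}

lemma hyp_extend_iff (ω : Config k) :
    (slabSetup k u α y n).Hyp (extend (ω ∘ toSlabEdge)) ↔ ω ∈ hypEvent k u α y n := by
  unfold hypEvent Setup.Hyp
  rw [Set.mem_inter_iff, Set.mem_inter_iff, and_assoc]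
  refine and_congr ?_ (and_congr ?_ ?_)
  · exact joins_extend_iff ω Set.subset_union_left
  · exact joins_extend_iff ω Set.subset_union_right
  · exact joins_extend_iff ω Set.subset_union_right

lemma concl_extend_iff (ω : Config k) :
    (slabSetup k u α y n).Concl (extend (ω ∘ toSlabEdge)) ↔ ω ∈ conclEvent k u y n := by
  unfold conclEvent Setup.Concl
  rw [← show region y n = box (3 * n) ∪ B' y n from rfl,
    ← joins_extend_iff (u := u) (α := α) ω (subset_refl (region y n))]
  have : {v : RegionVertex k y n | v.1.1 ∈ region y n} = Set.univ :=
    Set.eq_univ_of_forall fun v => v.2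
  rw [this]
  rfl

lemma hyp_extend_coord (η : State (RegionVertex k y n)) :
    (slabSetup k u α y n).Hyp (extend (η ∘ toCoord)) ↔ (slabSetup k u α y n).Hyp η := by
  unfold Setup.Hyp Setup.Joins
  rw [opn_extend_coord]

lemma concl_extend_coord (η : State (RegionVertex k y n)) :
    (slabSetup k u α y n).Concl (extend (η ∘ toCoord)) ↔ (slabSetup k u α y n).Concl η := by
  unfold Setup.Concl Setup.Joins
  rw [opn_extend_coord]

lemma bern_real_transfer (p : unitInterval) (A : Set (RegionEdge k y n → Bool)) :
    (bernoulliPerc k p).real {ω | ω ∘ toSlabEdge ∈ A} =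
      (bern (Coord (RegionVertex k y n)) p).real {η | η ∘ toCoord ∈ A} := by
  rw [bern_real_comp p _ toCoord_injective]
  exact bern_real_comp p _ toSlabEdge_injective A

/-- The event depends on finitely many edges, which supplies the measurability needed for the
complement formula. -/
lemma real_compl_hypEvent (p : unitInterval) :
    (bernoulliPerc k p).real (hypEvent k u α y n)ᶜ =
      1 - (bernoulliPerc k p).real (hypEvent k u α y n) := by
  have h1 : hypEvent k u α y n =
      {ω | ω ∘ toSlabEdge ∈ {ζ | (slabSetup k u α y n).Hyp (extend ζ)}} := by
    ext ω; exact (hyp_extend_iff ω).symm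
  have h2 : (hypEvent k u α y n)ᶜ =
      {ω | ω ∘ toSlabEdge ∈ {ζ | (slabSetup k u α y n).Hyp (extend ζ)}ᶜ} := by
    rw [h1]; rfl
  rw [h2, h1, bernoulliPerc, ← bern, bern_real_comp p _ toSlabEdge_injective,
    bern_real_comp p _ toSlabEdge_injective, measureReal_compl (Set.toFinite _).measurableSet]
  simp

/-- The gluing estimate when the parameter is bounded away from `0` and `1`. -/
theorem real_compl_conclEvent_le (p : unitInterval) {m : ℝ} (hm : 0 < m) (hm1 : m ≤ 1)
    (hp : ∀ b, m ≤ mass p b) {t : ℕ} (ht : 0 < t) (hu : ∀ m, 3 * u m ≤ m) (α : ℕ → ℕ) :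
    (bernoulliPerc k p).real (conclEvent k u y n)ᶜ ≤
      (1 + (2 * m⁻¹) ^ (t * starConst k)) * (bernoulliPerc k p).real (hypEvent k u α y n)ᶜ +
        (2 * m⁻¹) ^ starConst k / t := by
  have h := Setup.bern_gluing p hm hm1 hp (starConst k)
    (card_star_le (k := k) (u := u) (α := α) (y := y) (n := n)) t (planar_slabSetup hu) ht
  have e1 : (bernoulliPerc k p).real (hypEvent k u α y n)ᶜ =
      (bern (Coord (RegionVertex k y n)) p).real {η | ¬ (slabSetup k u α y n).Hyp η} := by
    have := bern_real_transfer (k := k) (y := y) (n := n) p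
      {ζ | ¬ (slabSetup k u α y n).Hyp (extend ζ)}
    convert this using 2
    · ext ω; exact not_congr (hyp_extend_iff ω).symm
    · ext η; exact not_congr (hyp_extend_coord η).symm
  have e2 : (bernoulliPerc k p).real (conclEvent k u y n)ᶜ =
      (bern (Coord (RegionVertex k y n)) p).real {η | ¬ (slabSetup k u α y n).Concl η} := by
    have := bern_real_transfer (k := k) (y := y) (n := n) p
      {ζ | ¬ (slabSetup k u α y n).Concl (extend ζ)}
    convert this using 2
    · ext ω; exact not_congr (concl_extend_iff ω).symm
    · ext η; exact not_congr (concl_extend_coord η).symm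
  rw [e1, e2]
  exact h

end transfer

instance (k : ℕ) (p : unitInterval) : IsProbabilityMeasure (bernoulliPerc k p) :=
  inferInstanceAs (IsProbabilityMeasure (bern _ p))

/-! ### Parameters close to `0` or `1`. -/

section extreme

variable {k : ℕ} {u α y : ℕ → ℕ} {n : ℕ} (p : unitInterval)

lemma reachIn_region {ω : Config k} {B : Set (ℤ × ℤ)} (hB : B ⊆ region y n) {a b : Vertex k}
    (h : ReachIn (openGraph ω).Adj (lift k B) a b) :
    ReachIn (openGraph ω).Adj (lift k (region y n)) a b :=
  h.mono (fun _ _ _ _ h => h) fun _ hv => hB hv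

/-- For small parameters, the hypothesis of the gluing lemma is unlikely. -/
theorem real_hypEvent_le (hu : ∀ m, 3 * u m ≤ m) (hy : ∀ m, y m ≤ m) (hn : 1 ≤ n) :
    (bernoulliPerc k p).real (hypEvent k u α y n) ≤ chainConst k * mass p true := by
  have hun := hu n
  refine le_trans (measureReal_mono ?_ (measure_ne_top _ _))
    (bern_real_linked_le (k := k) p true hn (x₀ := 2 * n + u n) (by omega))
  rintro ω ⟨_, hω⟩
  obtain ⟨a, ha, b, hb, h⟩ := mem_connected_iff.1 hω
  rw [mem_lift, mem_S'] at ha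
  rw [mem_lift, mem_Yplus] at hb
  exact linked_of_reach (hy _) (reachIn_region Set.subset_union_right h) ha.1.2 (by omega) hb.1

/-- For parameters close to `1`, the hypothesis is unlikely to hold without the conclusion. -/
theorem real_hypEvent_diff_le (hu : ∀ m, 3 * u m ≤ m) (hy : ∀ m, y m ≤ m) (hn : 1 ≤ n) :
    (bernoulliPerc k p).real (hypEvent k u α y n \ conclEvent k u y n) ≤
      chainConst k * mass p false := by
  have hun := hu n
  have hu3 := hu (3 * n)
  refine le_trans (measureReal_mono ?_ (measure_ne_top _ _))
    (bern_real_linked_le (k := k) p false hn (x₀ := 2 * n + u n) (by omega))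
  rintro ω ⟨⟨⟨hZ, _⟩, hY⟩, hc⟩
  obtain ⟨a, ha, b, hb, h⟩ := mem_connected_iff.1 hY
  obtain ⟨s, hs, z, hz, h'⟩ := mem_connected_iff.1 hZ
  have hsep : ¬ ReachIn (openGraph ω).Adj (lift k (region y n)) s a := fun hsa =>
    hc (mem_connected_iff.2 ⟨s, hs, a, ha, hsa⟩)
  rw [mem_lift, mem_S'] at ha
  rw [mem_lift, mem_Yplus] at hb
  rw [mem_lift, S, mem_box] at hs
  rw [mem_lift, mem_Z] at hz
  exact linked_of_separated (hy _) (by omega) (reachIn_region Set.subset_union_left h')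
    (reachIn_region Set.subset_union_right h) hsep (by omega) ha.1.2 hz.1 hb.1

end extreme

/-! ### Choice of constants and conclusion. -/

/-- The gluing lemma. -/
theorem gluing (k : ℕ) (ε : ℝ) (hε : 0 < ε) :
    ∃ δ : ℝ, 0 < δ ∧ ∀ (p : unitInterval) (u α y : ℕ → ℕ), (∀ m, 3 * u m ≤ m) →
      (∀ m, y m ≤ m) → ∀ n : ℕ, 1 ≤ n →
      1 - δ ≤ (bernoulliPerc k p).real (hypEvent k u α y n) →
      1 - ε ≤ (bernoulliPerc k p).real (conclEvent k u y n) := by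
  have hK : (0 : ℝ) < chainConst k := by
    unfold chainConst; positivity
  set K : ℝ := (chainConst k : ℝ)
  -- If `p < m`, the first threshold gives the hypothesis probability at most `1/2`. If `1 - p < m`,
  -- the second makes hypothesis without conclusion have probability at most `ε/2`.
  set m : ℝ := min 1 (min (1 / (2 * K)) (ε / (2 * K))) with hm
  have hm0 : 0 < m := lt_min one_pos (lt_min (by positivity) (by positivity))
  have hm1 : m ≤ 1 := min_le_left _ _
  have hmK : K * m ≤ 1 / 2 := by
    have h : m ≤ 1 / (2 * K) := (min_le_right _ _).trans (min_le_left _ _)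
    calc K * m ≤ K * (1 / (2 * K)) := mul_le_mul_of_nonneg_left h hK.le
      _ = 1 / 2 := by field_simp
  have hmε : K * m ≤ ε / 2 := by
    have h : m ≤ ε / (2 * K) := (min_le_right _ _).trans (min_le_right _ _)
    calc K * m ≤ K * (ε / (2 * K)) := mul_le_mul_of_nonneg_left h hK.le
      _ = ε / 2 := by field_simp
  -- With this `t`, many candidates cost at most `ε/2`. The factor `c` paid for few candidates is
  -- then fixed and absorbed by `δ`.
  obtain ⟨t, ht⟩ := exists_nat_gt ((2 * m⁻¹) ^ starConst k / (ε / 2))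
  have ht0 : (0 : ℝ) < t := lt_of_le_of_lt (by positivity) ht
  have htε : (2 * m⁻¹) ^ starConst k / t ≤ ε / 2 := by
    rw [div_lt_iff₀ (by positivity)] at ht
    rw [div_le_iff₀ ht0]
    linarith
  set c : ℝ := 1 + (2 * m⁻¹) ^ (t * starConst k) with hc
  have hc1 : 1 ≤ c := le_add_of_nonneg_right (by positivity)
  -- The bound `1/4` makes `1 - δ` exceed `1/2`, which rules out `p < m`.
  refine ⟨min (1 / 4) (ε / (2 * c)), lt_min (by norm_num) (by positivity), ?_⟩
  intro p u α y hu hy n hn hX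
  set δ : ℝ := min (1 / 4) (ε / (2 * c)) with hδ
  have hδ1 : δ ≤ 1 / 4 := min_le_left _ _
  have hδc : c * δ ≤ ε / 2 := by
    calc c * δ ≤ c * (ε / (2 * c)) := mul_le_mul_of_nonneg_left (min_le_right _ _) (by linarith)
      _ = ε / 2 := by field_simp
  have hXc := real_compl_hypEvent (k := k) (u := u) (α := α) (y := y) (n := n) p
  have htot : 1 ≤ (bernoulliPerc k p).real (conclEvent k u y n) +
      (bernoulliPerc k p).real (conclEvent k u y n)ᶜ := by
    have := measureReal_union_le (μ := bernoulliPerc k p) (conclEvent k u y n)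
      (conclEvent k u y n)ᶜ
    rwa [Set.union_compl_self, probReal_univ] at this
  suffices h : (bernoulliPerc k p).real (conclEvent k u y n)ᶜ ≤ ε by linarith
  by_cases hp1 : mass p true < m
  · have h1 := real_hypEvent_le (k := k) (α := α) p hu hy hn
    have h2 : K * mass p true ≤ K * m := mul_le_mul_of_nonneg_left hp1.le hK.le
    linarith
  by_cases hp0 : mass p false < m
  · have h1 := real_hypEvent_diff_le (k := k) (α := α) p hu hy hn
    have h2 : K * mass p false ≤ K * m := mul_le_mul_of_nonneg_left hp0.le hK.le
    have h3 : (conclEvent k u y n)ᶜ ⊆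
        (hypEvent k u α y n)ᶜ ∪ (hypEvent k u α y n \ conclEvent k u y n) := by
      intro ω hω
      by_cases hH : ω ∈ hypEvent k u α y n
      · exact .inr ⟨hH, hω⟩
      · exact .inl hH
    have h4 := (measureReal_mono (μ := bernoulliPerc k p) h3 (measure_ne_top _ _)).trans
      (measureReal_union_le _ _)
    have h5 : δ ≤ c * δ := by
      have : 0 ≤ δ := le_min (by norm_num) (by positivity)
      nlinarith
    linarith
  · have h1 := real_compl_conclEvent_le (k := k) (y := y) (n := n) p hm0 hm1
      (by rintro (_ | _) <;> simp only [not_lt] at hp0 hp1 <;> assumption)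
      (by exact_mod_cast ht0 : 0 < t) hu α
    have h2 : c * (bernoulliPerc k p).real (hypEvent k u α y n)ᶜ ≤ c * δ :=
      mul_le_mul_of_nonneg_left (by linarith) (by linarith)
    linarith

end SlabPercolation

theorem mainTheorem4 (k : ℕ) (ε : ℝ) (hε : 0 < ε) :
    ∃ δ : ℝ, 0 < δ ∧
      ∀ (p : unitInterval) (u α y : ℕ → ℕ),
        (∀ m, 3 * u m ≤ m) → (∀ m, α m ≤ m) → (∀ m, y m ≤ m) →
        ∀ n : ℕ, 1 ≤ n →
          1 - δ ≤ (SlabPercolation.bernoulliPerc k p).real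
            (SlabPercolation.connected k (SlabPercolation.box (3 * n))
                (SlabPercolation.S u (3 * n)) (SlabPercolation.Z α y n) ∩
              SlabPercolation.connected k (SlabPercolation.B' y n)
                (SlabPercolation.S' u y n) (SlabPercolation.Yminus α y n) ∩
              SlabPercolation.connected k (SlabPercolation.B' y n)
                (SlabPercolation.S' u y n) (SlabPercolation.Yplus α y n)) →
          1 - ε ≤ (SlabPercolation.bernoulliPerc k p).real
            (SlabPercolation.connected k
              (SlabPercolation.box (3 * n) ∪ SlabPercolation.B' y n)
              (SlabPercolation.S u (3 * n)) (SlabPercolation.S' u y n)) := by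
  obtain ⟨δ, hδ, h⟩ := SlabPercolation.gluing k ε hε
  exact ⟨δ, hδ, fun p u α y hu _ hy n hn hX => h p u α y hu hy n hn hX⟩
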